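/- Let $0<\varepsilon<1/2$, and for $n\ge 1$ put $$k=\lfloor n^{(1-2\varepsilon)(1-\varepsilon)}\rfloor,\qquad \delta=n^{-5\varepsilon/4+\varepsilon^2/2}.$$ The RIP parameter of order $k$ of a matrix $\Phi$ with $N$ columns is the least $\delta'\ge 0$ such that $(1-\delta')\|x\|^2\le\|\Phi x\|^2\le(1+\delta')\|x\|^2$ for all $x\in\mathbb C^N$ with at most $k$ nonzero coordinates. Algorithms receive matrices with rational entries, each given by its numerator and denominator in binary. Let $(H'_\varepsilon)$ be the hypothesis that there is no polynomial-time randomized algorithm which, given as input a graph $G$ on $n$ vertices, * always (for every outcome of its coin tosses) outputs "yes" if $G$ contains a clique of size $\lfloor n^{1/2-\varepsilon}\rfloor$; * outputs "no" with probability at least $3/4$ over its own coin tosses on most graphs, that is, on a proportion of the graphs on the vertex set $\{1,\dots,n\}$ that tends to $1$ as $n\to\infty$. Assume $(H'_\varepsilon)$. Then: 1. No (deterministic) polynomial-time algorithm can, for all sufficiently large $n$, distinguish the matrices with RIP parameter of order $k$ at most $\delta$ from the matrices with RIP parameter of order $k$ at least $n^{-\varepsilon}/4$; this holds already for $n\times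 n$ matrices. 2. Polynomial-time distinction between these two cases remains impossible for matrices of size $2n\times 100n$. 3. $\delta=o(n^{-\varepsilon}/4)$ as $n\to\infty$, and for matrices of size $2n\times100n$ no polynomial-time algorithm can approximate the RIP parameter $\rho$ of order $k$ within any constant factor: for no constant $c\ge 1$ is there a polynomial-time algorithm that, for all sufficiently large $n$, outputs on every such matrix a fraction $q$ with $\rho\le cq$ and $q\le c\rho$. -/

import Mathlib

open Filter Topology Asymptotics

namespace RIPHardness

/-! ### Data and programs

The machine model is the textbook WHILE language over binary trees, in point-free form: a program
transforms one tree (which can hold any number of variables, as nested pairs) by means of constants,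
projections, pairing, sequencing, conditionals and unbounded loops.  Every elementary step that
touches a tree is charged the full size of that tree, so that the cost is polynomially related, in
both directions, to the running time of a Turing machine. -/

/-- Binary trees, the data on which programs operate. -/
inductive Data : Type
  | nil : Data
  | node : Data → Data → Data

namespace Data

/-- The size of a tree: its number of nodes and leaves. -/
def size : Data → ℕ
  | nil => 1
  | node a b => size a + size b + 1

/-- Left component; `nil` on `nil`. -/
def fst : Data → Data
  | nil => nil
  | node a _ => a

/-- Right component; `nil` on `nil`. -/
def snd : Data → Data
  | nil => nil
  | node _ b => b

end Data

/-- Programs. -/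
inductive Prog : Type
  | nil : Prog
  | id : Prog
  | fst : Prog
  | snd : Prog
  | pair : Prog → Prog → Prog
  | seq : Prog → Prog → Prog
  | cond : Prog → Prog → Prog → Prog
  | loop : Prog → Prog → Prog

/-- `Eval P x y t`: on input `x` the program `P` halts with output `y` at cost `t`.
The truth value "false" is `Data.nil`, every other tree is "true".
* `pair P Q` returns the pair of the results of `P` and of `Q`, both run on the input;
* `seq P Q` runs `P`, and then `Q` on its result;
* `cond B P Q` runs `P` if `B` returns "true", and `Q` otherwise;
* `loop B P` replaces `x` by `P x` as long as `B x` is "true". -/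
inductive Eval : Prog → Data → Data → ℕ → Prop
  | nil (x : Data) : Eval Prog.nil x Data.nil (x.size + 1)
  | id (x : Data) : Eval Prog.id x x (x.size + 1)
  | fst (x : Data) : Eval Prog.fst x x.fst (x.size + 1)
  | snd (x : Data) : Eval Prog.snd x x.snd (x.size + 1)
  | pair {P Q : Prog} {x y z : Data} {s t : ℕ} :
      Eval P x y s → Eval Q x z t →
        Eval (Prog.pair P Q) x (Data.node y z) (s + t + x.size + 1)
  | seq {P Q : Prog} {x y z : Data} {s t : ℕ} :
      Eval P x y s → Eval Q y z t → Eval (Prog.seq P Q) x z (s + t + 1)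
  | condTrue {B P Q : Prog} {x b y : Data} {s t : ℕ} :
      Eval B x b s → b ≠ Data.nil → Eval P x y t →
        Eval (Prog.cond B P Q) x y (s + t + x.size + 1)
  | condFalse {B P Q : Prog} {x y : Data} {s t : ℕ} :
      Eval B x Data.nil s → Eval Q x y t →
        Eval (Prog.cond B P Q) x y (s + t + x.size + 1)
  | loopStop {B P : Prog} {x : Data} {s : ℕ} :
      Eval B x Data.nil s → Eval (Prog.loop B P) x x (s + x.size + 1)
  | loopStep {B P : Prog} {x b y z : Data} {s t u : ℕ} :
      Eval B x b s → b ≠ Data.nil → Eval P x y t → Eval (Prog.loop B P) y z u →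
        Eval (Prog.loop B P) x z (s + t + u + x.size + 1)

/-- Programs are deterministic: output and cost are determined by the input. -/
theorem Eval.deterministic {P : Prog} {x y : Data} {t : ℕ} (h : Eval P x y t) :
    ∀ {y' : Data} {t' : ℕ}, Eval P x y' t' → y' = y ∧ t' = t := by
  induction h with
  | nil x => intro _ _ h'; cases h'; exact ⟨rfl, rfl⟩
  | id x => intro _ _ h'; cases h'; exact ⟨rfl, rfl⟩
  | fst x => intro _ _ h'; cases h'; exact ⟨rfl, rfl⟩
  | snd x => intro _ _ h'; cases h'; exact ⟨rfl, rfl⟩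
  | pair _ _ ih₁ ih₂ =>
    intro _ _ h'
    cases h' with
    | pair a b => obtain ⟨rfl, rfl⟩ := ih₁ a; obtain ⟨rfl, rfl⟩ := ih₂ b; exact ⟨rfl, rfl⟩
  | seq _ _ ih₁ ih₂ =>
    intro _ _ h'
    cases h' with
    | seq a b => obtain ⟨rfl, rfl⟩ := ih₁ a; obtain ⟨rfl, rfl⟩ := ih₂ b; exact ⟨rfl, rfl⟩
  | condTrue _ hb _ ih₁ ih₂ =>
    intro _ _ h'
    cases h' with
    | condTrue a _ b => obtain ⟨rfl, rfl⟩ := ih₁ a; obtain ⟨rfl, rfl⟩ := ih₂ b; exact ⟨rfl, rfl⟩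
    | condFalse a _ => exact absurd (ih₁ a).1.symm hb
  | condFalse _ _ ih₁ ih₂ =>
    intro _ _ h'
    cases h' with
    | condTrue a hb _ => exact absurd (ih₁ a).1 hb
    | condFalse a b => obtain ⟨_, rfl⟩ := ih₁ a; obtain ⟨rfl, rfl⟩ := ih₂ b; exact ⟨rfl, rfl⟩
  | loopStop _ ih₁ =>
    intro _ _ h'
    cases h' with
    | loopStop a => obtain ⟨_, rfl⟩ := ih₁ a; exact ⟨rfl, rfl⟩
    | loopStep a hb _ _ => exact absurd (ih₁ a).1 hb
  | loopStep _ hb _ _ ih₁ ih₂ ih₃ =>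
    intro _ _ h'
    cases h' with
    | loopStop a => exact absurd (ih₁ a).1.symm hb
    | loopStep a _ b c =>
      obtain ⟨rfl, rfl⟩ := ih₁ a; obtain ⟨rfl, rfl⟩ := ih₂ b
      obtain ⟨rfl, rfl⟩ := ih₃ c; exact ⟨rfl, rfl⟩

/-- On input `x` the program `P` halts with output `y`. -/
def Outputs (P : Prog) (x y : Data) : Prop := ∃ t, Eval P x y t

/-- `P` halts on every tree of the set `inputs`, within a number of steps that is bounded by a
polynomial in the size of the input. -/
def PolyTimeOn (P : Prog) (inputs : Set Data) : Prop :=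
  ∃ q : Polynomial ℕ, ∀ x ∈ inputs, ∃ y t, Eval P x y t ∧ t ≤ q.eval x.size

/-! ### Encodings of the inputs and outputs -/

/-- `false` is `nil`, `true` is `node nil nil`. -/
def encBool : Bool → Data
  | false => Data.nil
  | true => Data.node Data.nil Data.nil

/-- A list is encoded by iterated pairing. -/
def encList : List Data → Data
  | [] => Data.nil
  | a :: l => Data.node a (encList l)

/-- Natural numbers in binary, least significant bit first. -/
def encNat (n : ℕ) : Data := encList (n.bits.map encBool)

/-- Integers by sign and absolute value. -/
def encInt (a : ℤ) : Data := Data.node (encBool (decide (a < 0))) (encNat a.natAbs)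

/-- The fraction `a / b`. -/
def encFrac (a : ℤ) (b : ℕ) : Data := Data.node (encInt a) (encNat b)

/-- Rational numbers by numerator and denominator, in lowest terms. -/
def encRat (q : ℚ) : Data := encFrac q.num q.den

/-- Rational matrices as the list of their rows. -/
def encMatrix {m N : ℕ} (Φ : Matrix (Fin m) (Fin N) ℚ) : Data :=
  encList (List.ofFn fun i => encList (List.ofFn fun j => encRat (Φ i j)))

open Classical in
/-- Graphs by the list of the rows of the adjacency matrix. -/
noncomputable def encGraph {n : ℕ} (G : SimpleGraph (Fin n)) : Data :=
  encList (List.ofFn fun i => encList (List.ofFn fun j => encBool (decide (G.Adj i j))))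

/-- Finite sequences of coin tosses. -/
def encCoins {m : ℕ} (r : Fin m → Bool) : Data := encList (List.ofFn fun i => encBool (r i))

/-- The answer "yes". -/
def yes : Data := encBool true

/-- The answer "no". -/
def no : Data := encBool false

/-! ### The clique hypothesis -/

/-- The proportion of the coin sequences of length `m` for which `P` answers "no" on the graph
`G`. -/
noncomputable def probNo (P : Prog) (m : ℕ) {n : ℕ} (G : SimpleGraph (Fin n)) : ℝ :=
  ({r : Fin m → Bool | Outputs P (Data.node (encGraph G) (encCoins r)) no}.ncard : ℝ) / 2 ^ m

/-- The randomized algorithm that tosses `ℓ(n)` coins on graphs with `n` vertices and runs `P` on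
the graph and the outcome of the tosses
* runs in polynomial time,
* answers "yes", whatever the coin tosses, on every graph on `n` vertices with a clique of size
  `n ^ (1/2 - ε)`,
* answers "no" with probability at least `3/4` over the coin tosses, on a proportion of the graphs
  on `n` vertices that tends to `1` as `n → ∞`. -/
def RefutesCliques (ε : ℝ) (P : Prog) (ℓ : Polynomial ℕ) : Prop :=
  PolyTimeOn P {x | ∃ (n : ℕ) (G : SimpleGraph (Fin n)) (r : Fin (ℓ.eval n) → Bool),
      x = Data.node (encGraph G) (encCoins r)} ∧
  (∀ (n : ℕ) (G : SimpleGraph (Fin n)), ¬ G.CliqueFree ⌊(n : ℝ) ^ (1 / 2 - ε)⌋₊ →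
      ∀ r : Fin (ℓ.eval n) → Bool, Outputs P (Data.node (encGraph G) (encCoins r)) yes) ∧
  Tendsto (fun n : ℕ =>
      ({G : SimpleGraph (Fin n) | 3 / 4 ≤ probNo P (ℓ.eval n) G}.ncard : ℝ) /
        (Nat.card (SimpleGraph (Fin n)) : ℝ)) atTop (𝓝 1)

/-- The randomized hypothesis: no randomized polynomial time algorithm certifies the absence of
cliques of size `n ^ (1/2 - ε)` in most graphs. -/
def CliqueHypothesis (ε : ℝ) : Prop :=
  ¬ ∃ (P : Prog) (ℓ : Polynomial ℕ), RefutesCliques ε P ℓ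

/-! ### The restricted isometry property -/

/-- The restricted isometry property of order `k` with parameter `δ`:
`(1 - δ) ‖x‖² ≤ ‖Φ x‖² ≤ (1 + δ) ‖x‖²` for every `k`-sparse complex vector `x`. -/
def SatisfiesRIP {m N : ℕ} (Φ : Matrix (Fin m) (Fin N) ℂ) (k : ℕ) (δ : ℝ) : Prop :=
  ∀ x : Fin N → ℂ, {j | x j ≠ 0}.ncard ≤ k →
    (1 - δ) * ∑ j, ‖x j‖ ^ 2 ≤ ∑ i, ‖Φ.mulVec x i‖ ^ 2 ∧
    ∑ i, ‖Φ.mulVec x i‖ ^ 2 ≤ (1 + δ) * ∑ j, ‖x j‖ ^ 2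

/-- The RIP parameter of order `k`: the least `δ ≥ 0` for which the RIP of order `k` holds. -/
noncomputable def ripParam {m N : ℕ} (Φ : Matrix (Fin m) (Fin N) ℂ) (k : ℕ) : ℝ :=
  sInf {δ : ℝ | 0 ≤ δ ∧ SatisfiesRIP Φ k δ}

/-- The RIP parameter of order `k` of a rational matrix. -/
noncomputable def ripParamRat {m N : ℕ} (Φ : Matrix (Fin m) (Fin N) ℚ) (k : ℕ) : ℝ :=
  ripParam (Φ.map fun q : ℚ => (q : ℂ)) k

/-- The order `k = n ^ ((1 - 2ε)(1 - ε))`. -/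
noncomputable def ripOrder (ε : ℝ) (n : ℕ) : ℕ := ⌊(n : ℝ) ^ ((1 - 2 * ε) * (1 - ε))⌋₊

/-- The small parameter `δ = n ^ (-5ε/4 + ε²/2)`. -/
noncomputable def lowParam (ε : ℝ) (n : ℕ) : ℝ := (n : ℝ) ^ (-5 * ε / 4 + ε ^ 2 / 2)

/-- The large parameter `n ^ (-ε) / 4`. -/
noncomputable def highParam (ε : ℝ) (n : ℕ) : ℝ := (n : ℝ) ^ (-ε) / 4

/-- The encodings of all rational matrices of size `rows n × cols n`, for all `n`. -/
def matrixInputs (rows cols : ℕ → ℕ) : Set Data :=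
  {x | ∃ (n : ℕ) (Φ : Matrix (Fin (rows n)) (Fin (cols n)) ℚ), x = encMatrix Φ}

/-- `P` runs in polynomial time on the matrices of size `rows n × cols n` and, for all large
enough `n`, distinguishes those with RIP parameter of order `k` at most `δ` from those with RIP
parameter of order `k` at least `n ^ (-ε) / 4`. -/
def DistinguishesRIP (ε : ℝ) (rows cols : ℕ → ℕ) (P : Prog) : Prop :=
  PolyTimeOn P (matrixInputs rows cols) ∧
  ∀ᶠ n : ℕ in atTop, ∀ Φ : Matrix (Fin (rows n)) (Fin (cols n)) ℚ,
    (ripParamRat Φ (ripOrder ε n) ≤ lowParam ε n → Outputs P (encMatrix Φ) yes) ∧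
    (highParam ε n ≤ ripParamRat Φ (ripOrder ε n) → Outputs P (encMatrix Φ) no)

/-- `P` runs in polynomial time on the matrices of size `rows n × cols n` and, for all large
enough `n`, outputs a fraction that approximates their RIP parameter of order `k` within the
factor `c`. -/
def ApproximatesRIP (ε c : ℝ) (rows cols : ℕ → ℕ) (P : Prog) : Prop :=
  PolyTimeOn P (matrixInputs rows cols) ∧
  ∀ᶠ n : ℕ in atTop, ∀ Φ : Matrix (Fin (rows n)) (Fin (cols n)) ℚ,
    ∃ (a : ℤ) (b : ℕ), 0 < b ∧ Outputs P (encMatrix Φ) (encFrac a b) ∧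
      ripParamRat Φ (ripOrder ε n) ≤ c * ((a : ℝ) / b) ∧
      (a : ℝ) / b ≤ c * ripParamRat Φ (ripOrder ε n)

end RIPHardness

/-! To a graph on n vertices attach the two matrices M₊ and M₋ given by 3/5 I ± A/(5t), where A has
entries +1 at edges and -1 at non-edges off the diagonal, and 4t is about √n. Both signs are used
because of what a clique must do in every graph, even an adversarial one. In ‖M₊x‖² - ‖M₋x‖² the
uncontrolled term ‖Ax‖² cancels and only a multiple of ⟨x, Ax⟩ survives, which on the indicator of a
clique of size w is w(w - 1) (`graphMatrix_sq_sub_sq`). So at least one of the two squared norms is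
off by n^(-ε)/4 relative to ‖x‖² = w (`le_ripParamRat_of_clique`).

For a random graph both matrices have RIP parameter at most δ with probability tending to 1. At a
fixed vector, ‖Mx‖² is a sum of squares of affine forms in independent signs, and each sign enters
at most two of the forms. Averaging over the signs one at a time bounds the moment generating
function (`sum_exp_sum_sq_le`), hence a fixed vector fails with probability at most 2 exp(-δ²n/256)
(`card_deviation_le`). Rounding leaves only exp(O(k log n)) sparse vectors to consider
(`realRIP_of_grid`), and the exponents of k and δ are such that δ²n exceeds k by a positive power of
n, so that a union bound suffices (`card_not_realRIP_le`, `tendsto_failure`).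

A distinguisher applied to M₊ and M₋ would therefore refute cliques. For 2n × 100n matrices a block
of n × 99n random signs, drawn from the coin tosses, is put on the diagonal next to M₊ or M₋. It has
a small RIP parameter for at least 3/4 of the tosses, and whatever the tosses it cannot hide a
clique, so the answer "yes" stays free of error (`not_distinguishesRIP`). An approximation algorithm
distinguishes too: its output is compared, through bit lengths alone, with a power n^(-p/s) lying
between δ and n^(-ε)/4 (`exists_threshold`). All the algorithms are realised as programs by closure
properties of polynomial time, chiefly closure under folds with intermediate results of polynomial
size (`PolyTime.foldl`). -/

namespace RIPHardness

/-! ### Trees as lists -/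

/-- The list encoded by a tree. -/
def Data.toList : Data → List Data
  | Data.nil => []
  | Data.node a l => a :: Data.toList l

@[simp] theorem toList_nil : Data.nil.toList = [] := rfl

@[simp] theorem toList_node (a l : Data) : (Data.node a l).toList = a :: l.toList := rfl

@[simp] theorem encList_nil : encList [] = Data.nil := rfl

@[simp] theorem encList_cons (a : Data) (l : List Data) :
    encList (a :: l) = Data.node a (encList l) := rfl

@[simp] theorem fst_node (a b : Data) : (Data.node a b).fst = a := rfl

@[simp] theorem snd_node (a b : Data) : (Data.node a b).snd = b := rfl

@[simp] theorem size_nil : Data.nil.size = 1 := rfl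

@[simp] theorem size_node (a b : Data) : (Data.node a b).size = a.size + b.size + 1 := rfl

@[simp] theorem encList_toList (d : Data) : encList d.toList = d := by
  induction d with
  | nil => rfl
  | node a l _ ih => simp [ih]

@[simp] theorem toList_encList (l : List Data) : (encList l).toList = l := by
  induction l with
  | nil => rfl
  | cons a l ih => simp [ih]

theorem Data.size_pos (d : Data) : 0 < d.size := by cases d <;> simp

theorem Data.size_fst_le (d : Data) : d.fst.size ≤ d.size := by
  cases d <;> simp [Data.fst]; omega

theorem Data.size_snd_le (d : Data) : d.snd.size ≤ d.size := by
  cases d <;> simp [Data.snd]; omega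

theorem Data.length_toList_le (d : Data) : d.toList.length ≤ d.size := by
  induction d with
  | nil => simp
  | node a l _ ih => simp; omega

theorem size_encList_le {l : List Data} {b : ℕ} (h : ∀ a ∈ l, a.size ≤ b) :
    (encList l).size ≤ l.length * (b + 1) + 1 := by
  induction l with
  | nil => simp
  | cons a l ih =>
    have h1 := ih fun c hc => h c (List.mem_cons_of_mem _ hc)
    have h2 := h a List.mem_cons_self
    simp only [encList_cons, size_node, List.length_cons]
    nlinarith

theorem Data.size_le_of_mem_toList {d a : Data} (h : a ∈ d.toList) : a.size ≤ d.size := by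
  induction d with
  | nil => simp at h
  | node b l _ ih =>
    rcases List.mem_cons.1 h with rfl | h
    · simp; omega
    · have := ih h; simp; omega

theorem Data.size_encList_drop_le (d : Data) (k : ℕ) :
    (encList (d.toList.drop k)).size ≤ d.size := by
  induction d generalizing k with
  | nil => simp
  | node b l _ ih =>
    cases k with
    | zero => simp
    | succ k => have := ih k; simp; omega

/-- Every elementary step is charged the size of the tree it touches, so a time bound is also an
output size bound. This is what makes polynomial time closed under composition. -/
theorem Eval.size_le {P : Prog} {x y : Data} {t : ℕ} (h : Eval P x y t) : y.size ≤ t := by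
  induction h with
  | nil x => simp
  | id x => omega
  | fst x => have := x.size_fst_le; omega
  | snd x => have := x.size_snd_le; omega
  | pair _ _ _ _ => simp; omega
  | seq _ _ _ _ => omega
  | condTrue _ _ _ _ _ => omega
  | condFalse _ _ _ _ => omega
  | loopStop _ _ => omega
  | loopStep _ _ _ _ _ _ _ => omega

theorem eval_mono_nat (q : Polynomial ℕ) {a b : ℕ} (h : a ≤ b) : q.eval a ≤ q.eval b := by
  rw [Polynomial.eval_eq_sum_range, Polynomial.eval_eq_sum_range]
  gcongr

/-! ### Functions computable in polynomial time -/

/-- Some program computes `f` on the trees of the set `S` in polynomial time. -/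
def PolyTimeFunOn (S : Set Data) (f : Data → Data) : Prop :=
  ∃ (P : Prog) (q : Polynomial ℕ), ∀ x ∈ S, ∃ t, Eval P x (f x) t ∧ t ≤ q.eval x.size

/-- Some program computes `f` in polynomial time. -/
def PolyTime (f : Data → Data) : Prop := PolyTimeFunOn Set.univ f

theorem PolyTimeFunOn.comp {S T : Set Data} {f g : Data → Data} (hg : PolyTimeFunOn T g)
    (hf : PolyTimeFunOn S f) (h : ∀ x ∈ S, f x ∈ T) : PolyTimeFunOn S fun x => g (f x) := by
  obtain ⟨P, p, hP⟩ := hf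
  obtain ⟨Q, q, hQ⟩ := hg
  refine ⟨P.seq Q, p + q.comp p + 1, fun x hx => ?_⟩
  obtain ⟨s, hs, hs'⟩ := hP x hx
  obtain ⟨t, ht, ht'⟩ := hQ _ (h x hx)
  refine ⟨_, Eval.seq hs ht, ?_⟩
  have := eval_mono_nat q (hs.size_le.trans hs')
  simp
  omega

theorem PolyTimeFunOn.pair {S : Set Data} {f g : Data → Data} (hf : PolyTimeFunOn S f)
    (hg : PolyTimeFunOn S g) : PolyTimeFunOn S fun x => Data.node (f x) (g x) := by
  obtain ⟨P, p, hP⟩ := hf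
  obtain ⟨Q, q, hQ⟩ := hg
  refine ⟨P.pair Q, p + q + Polynomial.X + 1, fun x hx => ?_⟩
  obtain ⟨s, hs, hs'⟩ := hP x hx
  obtain ⟨t, ht, ht'⟩ := hQ x hx
  exact ⟨_, Eval.pair hs ht, by simp; omega⟩

open Classical in
theorem PolyTimeFunOn.ite {S : Set Data} {b f g : Data → Data} (hb : PolyTimeFunOn S b)
    (hf : PolyTimeFunOn {x | x ∈ S ∧ b x ≠ Data.nil} f)
    (hg : PolyTimeFunOn {x | x ∈ S ∧ b x = Data.nil} g) :
    PolyTimeFunOn S fun x => if b x = Data.nil then g x else f x := by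
  obtain ⟨B, r, hB⟩ := hb
  obtain ⟨P, p, hP⟩ := hf
  obtain ⟨Q, q, hQ⟩ := hg
  refine ⟨Prog.cond B P Q, r + p + q + Polynomial.X + 1, fun x hx => ?_⟩
  obtain ⟨s, hs, hs'⟩ := hB x hx
  by_cases hn : b x = Data.nil
  · obtain ⟨t, ht, ht'⟩ := hQ x ⟨hx, hn⟩
    rw [hn] at hs
    simp only [hn, if_true]
    exact ⟨_, Eval.condFalse hs ht, by simp; omega⟩
  · obtain ⟨t, ht, ht'⟩ := hP x ⟨hx, hn⟩
    simp only [hn, if_false]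
    exact ⟨_, Eval.condTrue hs hn ht, by simp; omega⟩

theorem PolyTimeFunOn.mono {S T : Set Data} {f : Data → Data} (hf : PolyTimeFunOn T f)
    (h : S ⊆ T) : PolyTimeFunOn S f := by
  obtain ⟨P, p, hP⟩ := hf
  exact ⟨P, p, fun x hx => hP x (h hx)⟩

theorem PolyTime.on {f : Data → Data} (hf : PolyTime f) (S : Set Data) : PolyTimeFunOn S f :=
  PolyTimeFunOn.mono hf (Set.subset_univ _)

theorem PolyTime.comp {f g : Data → Data} (hg : PolyTime g) (hf : PolyTime f) :
    PolyTime fun x => g (f x) :=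
  PolyTimeFunOn.comp hg hf fun _ _ => trivial

theorem PolyTime.pair {f g : Data → Data} (hf : PolyTime f) (hg : PolyTime g) :
    PolyTime fun x => Data.node (f x) (g x) :=
  PolyTimeFunOn.pair hf hg

open Classical in
theorem PolyTime.ite {b f g : Data → Data} (hb : PolyTime b) (hf : PolyTime f)
    (hg : PolyTime g) : PolyTime fun x => if b x = Data.nil then g x else f x :=
  PolyTimeFunOn.ite hb (hf.on _) (hg.on _)

theorem PolyTime.id : PolyTime fun x => x :=
  ⟨Prog.id, Polynomial.X + 1, fun x _ => ⟨_, Eval.id x, by simp⟩⟩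

theorem PolyTime.nil : PolyTime fun _ => Data.nil :=
  ⟨Prog.nil, Polynomial.X + 1, fun x _ => ⟨_, Eval.nil x, by simp⟩⟩

theorem polyTime_fst : PolyTime Data.fst :=
  ⟨Prog.fst, Polynomial.X + 1, fun x _ => ⟨_, Eval.fst x, by simp⟩⟩

theorem polyTime_snd : PolyTime Data.snd :=
  ⟨Prog.snd, Polynomial.X + 1, fun x _ => ⟨_, Eval.snd x, by simp⟩⟩

theorem PolyTime.fst {f : Data → Data} (hf : PolyTime f) : PolyTime fun x => (f x).fst :=
  polyTime_fst.comp hf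

theorem PolyTime.snd {f : Data → Data} (hf : PolyTime f) : PolyTime fun x => (f x).snd :=
  polyTime_snd.comp hf

theorem PolyTime.const (d : Data) : PolyTime fun _ => d := by
  induction d with
  | nil => exact PolyTime.nil
  | node a b iha ihb => exact iha.pair ihb

theorem PolyTime.size_le {f : Data → Data} (hf : PolyTime f) :
    ∃ q : Polynomial ℕ, ∀ x, (f x).size ≤ q.eval x.size := by
  obtain ⟨P, q, h⟩ := hf
  refine ⟨q, fun x => ?_⟩
  obtain ⟨t, ht, ht'⟩ := h x trivial
  exact ht.size_le.trans ht'

/-- Polynomial time functions of two arguments. -/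
def PolyTime₂ (h : Data → Data → Data) : Prop := PolyTime fun z => h z.fst z.snd

/-- Polynomial time functions of three arguments. -/
def PolyTime₃ (h : Data → Data → Data → Data) : Prop :=
  PolyTime fun z => h z.fst z.snd.fst z.snd.snd

theorem PolyTime₂.comp {h : Data → Data → Data} (hh : PolyTime₂ h) {f g : Data → Data}
    (hf : PolyTime f) (hg : PolyTime g) : PolyTime fun x => h (f x) (g x) :=
  PolyTime.comp hh (hf.pair hg)

theorem PolyTime₃.comp {h : Data → Data → Data → Data} (hh : PolyTime₃ h) {f g k : Data → Data}
    (hf : PolyTime f) (hg : PolyTime g) (hk : PolyTime k) :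
    PolyTime fun x => h (f x) (g x) (k x) :=
  PolyTime.comp hh (hf.pair (hg.pair hk))

/-- Folding a polynomial time function over a list takes polynomial time, provided that the
intermediate results have polynomial size. -/
theorem PolyTime.foldl {h : Data → Data → Data → Data} {init l : Data → Data}
    (hh : PolyTime₃ h) (hi : PolyTime init) (hl : PolyTime l) (q : Polynomial ℕ)
    (bound : ∀ x, ∀ l', l' <+: (l x).toList →
      (l'.foldl (h x) (init x)).size ≤ q.eval x.size) :
    PolyTime fun x => (l x).toList.foldl (h x) (init x) := by
  obtain ⟨qₗ, hqₗ⟩ := hl.size_le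
  -- one round, on the state `(rest, (x, acc))`
  have hstep : PolyTime fun z => Data.node z.fst.snd
      (Data.node z.snd.fst (h z.snd.fst z.snd.snd z.fst.fst)) :=
    PolyTime.id.fst.snd.pair (PolyTime.id.snd.fst.pair
      (hh.comp PolyTime.id.snd.fst PolyTime.id.snd.snd PolyTime.id.fst.fst))
  obtain ⟨P, p, hP⟩ := hstep
  -- `B` bounds the size of the loop state in every round, and `C` the cost of one round: the body,
  -- the test and the charge of the loop itself.
  set B : Polynomial ℕ := qₗ + Polynomial.X + q + 3 with hB
  set C : Polynomial ℕ := p.comp B + 2 * B + 3 with hC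
  have key : ∀ x (rest done : List Data), done ++ rest = (l x).toList →
      ∃ t, Eval (Prog.loop Prog.fst P)
        (Data.node (encList rest) (Data.node x (done.foldl (h x) (init x))))
        (Data.node Data.nil (Data.node x ((l x).toList.foldl (h x) (init x)))) t ∧
        t ≤ (rest.length + 1) * C.eval x.size := by
    intro x rest
    induction rest with
    | nil =>
      intro done hd
      simp only [List.append_nil] at hd
      subst hd
      refine ⟨_, Eval.loopStop (Eval.fst _), ?_⟩
      have := bound x _ List.prefix_rfl
      simp only [encList_nil, size_node, size_nil, List.length_nil, hC, hB, Polynomial.eval_add,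
        Polynomial.eval_mul, Polynomial.eval_X, Polynomial.eval_ofNat]
      omega
    | cons a rest ih =>
      intro done hd
      have hd' : (done ++ [a]) ++ rest = (l x).toList := by simp [hd]
      obtain ⟨t, ht, ht'⟩ := ih _ hd'
      rw [List.foldl_append] at ht
      obtain ⟨u, hu, hu'⟩ := hP (Data.node (encList (a :: rest))
        (Data.node x (done.foldl (h x) (init x)))) trivial
      refine ⟨_, Eval.loopStep (Eval.fst _) (by simp) hu (by simpa using ht), ?_⟩
      have hs : (Data.node (encList (a :: rest))
          (Data.node x (done.foldl (h x) (init x)))).size ≤ B.eval x.size := by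
        have h1 := bound x done ⟨_, hd⟩
        have h2 := (l x).size_encList_drop_le done.length
        rw [← hd, List.drop_left] at h2
        have h3 := hqₗ x
        simp only [size_node, hB, Polynomial.eval_add, Polynomial.eval_X,
          Polynomial.eval_ofNat] at *
        omega
      have h4 := eval_mono_nat p hs
      have h5 : p.eval (B.eval x.size) + 2 * B.eval x.size + 3 = C.eval x.size := by
        simp [hC]
      rw [List.length_cons, add_mul (rest.length + 1), one_mul]
      omega
  have hstart : PolyTime fun x => Data.node (l x) (Data.node x (init x)) :=
    hl.pair (PolyTime.id.pair hi)
  obtain ⟨Q, r, hQ⟩ := hstart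
  have hloop : PolyTimeFunOn {z | ∃ x, z = Data.node (l x) (Data.node x (init x))}
      (fun z => Data.node Data.nil
        (Data.node z.snd.fst ((l z.snd.fst).toList.foldl (h z.snd.fst) (init z.snd.fst)))) := by
    refine ⟨Prog.loop Prog.fst P, (qₗ + 1) * C, ?_⟩
    rintro _ ⟨x, rfl⟩
    obtain ⟨t, ht, ht'⟩ := key x (l x).toList [] rfl
    refine ⟨t, by simpa using ht, ht'.trans ?_⟩
    have h1 : x.size ≤ (Data.node (l x) (Data.node x (init x))).size := by simp; omega
    have h2 := eval_mono_nat C h1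
    have h3 := eval_mono_nat qₗ h1
    have h4 := (l x).length_toList_le
    have h5 := hqₗ x
    rw [Polynomial.eval_mul]
    refine Nat.mul_le_mul ?_ h2
    simp only [Polynomial.eval_add, Polynomial.eval_one]
    omega
  have := PolyTimeFunOn.comp (polyTime_snd.comp polyTime_snd)
    (PolyTimeFunOn.comp hloop ⟨Q, r, hQ⟩ fun x _ => ⟨x, rfl⟩) fun _ _ => trivial
  simpa [PolyTime] using this

/-! ### A library of polynomial time functions on lists -/

/-- Folding takes polynomial time if every round adds at most polynomially many nodes. -/
theorem PolyTime.foldl_of_growth {h : Data → Data → Data → Data} {init l : Data → Data}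
    (hh : PolyTime₃ h) (hi : PolyTime init) (hl : PolyTime l) (g : Polynomial ℕ)
    (growth : ∀ x acc a, (h x acc a).size ≤ acc.size + g.eval (x.size + a.size)) :
    PolyTime fun x => (l x).toList.foldl (h x) (init x) := by
  obtain ⟨qₗ, hqₗ⟩ := hl.size_le
  obtain ⟨qᵢ, hqᵢ⟩ := hi.size_le
  refine PolyTime.foldl hh hi hl (qᵢ + qₗ * g.comp (Polynomial.X + qₗ)) fun x l' hl' => ?_
  have key : ∀ (l' : List Data) (acc : Data), (∀ a ∈ l', a.size ≤ qₗ.eval x.size) →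
      (l'.foldl (h x) acc).size ≤
        acc.size + l'.length * (g.comp (Polynomial.X + qₗ)).eval x.size := by
    intro l'
    induction l' with
    | nil => simp
    | cons a l' ih =>
      intro acc hacc
      have h1 := ih (h x acc a) fun b hb => hacc b (List.mem_cons_of_mem _ hb)
      have h2 := growth x acc a
      have h3 := hacc a List.mem_cons_self
      have h4 := eval_mono_nat g (Nat.add_le_add_left h3 x.size)
      have h5 : g.eval (x.size + qₗ.eval x.size) =
        (g.comp (Polynomial.X + qₗ)).eval x.size := by simp
      rw [List.foldl_cons, List.length_cons, add_mul, one_mul]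
      omega
  have h1 := key l' (init x) fun a ha =>
    (Data.size_le_of_mem_toList (hl'.subset ha)).trans (hqₗ x)
  have h2 : l'.length ≤ qₗ.eval x.size :=
    (hl'.length_le.trans (Data.length_toList_le _)).trans (hqₗ x)
  have h3 := Nat.mul_le_mul_right ((g.comp (Polynomial.X + qₗ)).eval x.size) h2
  have h4 := hqᵢ x
  rw [Polynomial.eval_add, Polynomial.eval_mul]
  omega

theorem foldl_node (l : List Data) (acc : Data) :
    l.foldl (fun acc a => Data.node a acc) acc = encList (l.reverse ++ acc.toList) := by
  induction l generalizing acc with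
  | nil => simp
  | cons a l ih => simp [ih]

theorem PolyTime.reverse {l : Data → Data} (hl : PolyTime l) :
    PolyTime fun x => encList (l x).toList.reverse := by
  have := PolyTime.foldl_of_growth (h := fun _ acc a => Data.node a acc) (init := fun _ => Data.nil)
    (PolyTime.id.snd.snd.pair PolyTime.id.snd.fst) PolyTime.nil hl (Polynomial.X + 1)
    (by intro x acc a; simp; omega)
  simpa [foldl_node] using this

/-- Consing while folding reverses, so the fold runs over the reversed first list and starts from
the second. -/
theorem PolyTime.append {l m : Data → Data} (hl : PolyTime l) (hm : PolyTime m) :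
    PolyTime fun x => encList ((l x).toList ++ (m x).toList) := by
  have := PolyTime.foldl_of_growth (h := fun _ acc a => Data.node a acc)
    (PolyTime.id.snd.snd.pair PolyTime.id.snd.fst) hm hl.reverse (Polynomial.X + 1)
    (by intro x acc a; simp; omega)
  simpa only [foldl_node, toList_encList, List.reverse_reverse] using this

theorem snd_eq_drop (d : Data) : d.snd = encList (d.toList.drop 1) := by
  cases d <;> simp [Data.snd]

theorem iterate_snd (k : ℕ) (d : Data) : Data.snd^[k] d = encList (d.toList.drop k) := by
  induction k with
  | zero => simp
  | succ k ih => rw [Function.iterate_succ_apply', ih, snd_eq_drop]; simp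

theorem foldl_iterate {α β : Type*} (f : α → α) (l : List β) (x : α) :
    l.foldl (fun y _ => f y) x = f^[l.length] x := by
  induction l generalizing x with
  | nil => rfl
  | cons a l ih => simp [ih]

/-- Dropping as many elements of a list as another list has. -/
theorem PolyTime.drop_length {l m : Data → Data} (hl : PolyTime l) (hm : PolyTime m) :
    PolyTime fun x => encList ((m x).toList.drop (l x).toList.length) := by
  have := PolyTime.foldl_of_growth (h := fun _ acc _ => acc.snd)
    PolyTime.id.snd.fst.snd hm hl 0 (by intro x acc a; simpa using acc.size_snd_le)
  simpa [foldl_iterate, iterate_snd] using this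

/-- Mapping a polynomial time function over a list, while a state is updated repeatedly. -/
theorem PolyTime.mapIdx_iterate {g : Data → Data → Data → Data} {σ : Data → Data → Data}
    {s l : Data → Data} (hg : PolyTime₃ g) (hσ : PolyTime₂ σ) (hs : PolyTime s) (hl : PolyTime l)
    (q : Polynomial ℕ)
    (bound : ∀ x i, i ≤ (l x).toList.length → ((σ x)^[i] (s x)).size ≤ q.eval x.size) :
    PolyTime fun x => encList ((l x).toList.mapIdx fun i a => g x ((σ x)^[i] (s x)) a) := by
  -- The accumulator holds the current state and the output so far, in reverse order.
  have spec : ∀ (x : Data) (l' : List Data),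
      l'.foldl (fun acc a => Data.node (σ x acc.fst) (Data.node (g x acc.fst a) acc.snd))
        (Data.node (s x) Data.nil) =
      Data.node ((σ x)^[l'.length] (s x))
        (encList (l'.mapIdx fun i a => g x ((σ x)^[i] (s x)) a).reverse) := by
    intro x l'
    induction l' using List.reverseRecOn with
    | nil => simp
    | append_singleton l' a ih =>
      simp [List.foldl_append, ih, Function.iterate_succ_apply']
  obtain ⟨qₗ, hqₗ⟩ := hl.size_le
  obtain ⟨p, hp⟩ := PolyTime.size_le hg
  have := PolyTime.foldl
    (h := fun x acc a => Data.node (σ x acc.fst) (Data.node (g x acc.fst a) acc.snd))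
    (init := fun x => Data.node (s x) Data.nil)
    ((hσ.comp PolyTime.id.fst PolyTime.id.snd.fst.fst).pair
      ((hg.comp PolyTime.id.fst PolyTime.id.snd.fst.fst PolyTime.id.snd.snd).pair
        PolyTime.id.snd.fst.snd))
    (hs.pair PolyTime.nil) hl
    (q + qₗ * (p.comp (Polynomial.X + q + qₗ + 2) + 1) + 2) (by
      intro x l' hl'
      rw [spec]
      have h1 := bound x l'.length hl'.length_le
      have h2 : (encList (l'.mapIdx fun i a => g x ((σ x)^[i] (s x)) a).reverse).size ≤
          (l'.mapIdx fun i a => g x ((σ x)^[i] (s x)) a).reverse.length *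
            (p.eval (x.size + q.eval x.size + qₗ.eval x.size + 2) + 1) + 1 := by
        refine size_encList_le fun b hb => ?_
        rw [List.mem_reverse, List.mem_mapIdx] at hb
        obtain ⟨i, hi, rfl⟩ := hb
        have h3 := hp (Data.node x (Data.node ((σ x)^[i] (s x)) l'[i]))
        refine h3.trans (eval_mono_nat p ?_)
        have h4 := bound x i (hi.le.trans hl'.length_le)
        have h5 := (Data.size_le_of_mem_toList (hl'.subset (List.getElem_mem hi))).trans (hqₗ x)
        simp only [size_node]
        omega
      rw [List.length_reverse, List.length_mapIdx] at h2
      have h3 : l'.length ≤ qₗ.eval x.size :=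
        (hl'.length_le.trans (Data.length_toList_le _)).trans (hqₗ x)
      have h4 := Nat.mul_le_mul_right
        (p.eval (x.size + q.eval x.size + qₗ.eval x.size + 2) + 1) h3
      simp only [size_node, Polynomial.eval_add, Polynomial.eval_mul, Polynomial.eval_comp,
        Polynomial.eval_X, Polynomial.eval_ofNat, Polynomial.eval_one]
      omega)
  have := this.snd.reverse
  simpa [spec] using this

/-- Mapping a polynomial time function over a list. -/
theorem PolyTime.map {g : Data → Data → Data} {l : Data → Data} (hg : PolyTime₂ g)
    (hl : PolyTime l) : PolyTime fun x => encList ((l x).toList.map (g x)) := by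
  have := PolyTime.mapIdx_iterate (g := fun x _ a => g x a) (σ := fun _ s => s)
    (s := fun _ => Data.nil) (hg.comp PolyTime.id.fst PolyTime.id.snd.snd) PolyTime.id.snd
    PolyTime.nil hl 1 (by intro x i _; rw [Function.iterate_fixed rfl]; simp)
  simpa [List.mapIdx_eq_zipIdx_map, ← Function.comp_def, ← List.map_map] using this

/-- The concatenation of `c` copies of a list. -/
theorem PolyTime.flatten_replicate (c : ℕ) {l : Data → Data} (hl : PolyTime l) :
    PolyTime fun x => encList (List.replicate c (l x).toList).flatten := by
  induction c with
  | zero => simpa using PolyTime.nil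
  | succ c ih => simpa [List.replicate_succ] using hl.append ih

/-! ### Binary numerals -/

/-- Increment of a binary numeral, least significant bit first. -/
def incBits : List Bool → List Bool
  | [] => [true]
  | false :: l => true :: l
  | true :: l => false :: incBits l

theorem incBits_bits (n : ℕ) : incBits n.bits = (n + 1).bits := by
  induction n using Nat.binaryRec' with
  | zero => rfl
  | bit b n h ih =>
    rw [Nat.bits_append_bit n b h]
    cases b with
    | false =>
      rw [incBits, show Nat.bit false n + 1 = Nat.bit true n by simp [Nat.bit],
        Nat.bits_append_bit n true (by simp)]
    | true =>
      rw [incBits, ih, show Nat.bit true n + 1 = Nat.bit false (n + 1) by simp [Nat.bit]; ring,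
        Nat.bits_append_bit (n + 1) false (by simp)]

open Classical in
/-- One round of the increment: the state consists of the carry and of the digits so far. -/
noncomputable def incStep (acc a : Data) : Data :=
  if acc.fst = Data.nil then Data.node Data.nil (Data.node a acc.snd)
  else if a = Data.nil then Data.node Data.nil (Data.node yes acc.snd)
  else Data.node yes (Data.node no acc.snd)

open Classical in
/-- Final round of the increment. -/
noncomputable def incEnd (acc : Data) : Data :=
  if acc.fst = Data.nil then acc.snd else Data.node yes acc.snd

theorem encBool_true : encBool true = yes := rfl

@[simp] theorem yes_ne_nil : yes ≠ Data.nil := by simp [yes, encBool]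

@[simp] theorem encBool_eq_nil {b : Bool} : encBool b = Data.nil ↔ b = false := by
  cases b <;> simp [encBool]

theorem incEnd_foldl_noCarry (l : List Bool) (d : Data) :
    incEnd ((l.map encBool).foldl incStep (Data.node Data.nil d)) =
      encList ((l.map encBool).reverse ++ d.toList) := by
  induction l generalizing d with
  | nil => simp [incEnd]
  | cons b l ih =>
    rw [List.map_cons, List.foldl_cons, incStep, if_pos (by simp), ih]
    simp

theorem incEnd_foldl_carry (l : List Bool) (d : Data) :
    incEnd ((l.map encBool).foldl incStep (Data.node yes d)) =
      encList (((incBits l).map encBool).reverse ++ d.toList) := by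
  induction l generalizing d with
  | nil => simp [incEnd, incBits, encBool_true]
  | cons b l ih =>
    rw [List.map_cons, List.foldl_cons, incStep]
    cases b with
    | false =>
      rw [fst_node, if_neg yes_ne_nil, if_pos (by simp), incEnd_foldl_noCarry]
      simp [incBits, encBool_true]
    | true =>
      rw [fst_node, if_neg yes_ne_nil, if_neg (by simp), ih]
      simp [incBits, no]

theorem polyTime₂_incStep : PolyTime₂ incStep :=
  PolyTime.ite PolyTime.id.fst.fst
    (PolyTime.ite PolyTime.id.snd
      ((PolyTime.const yes).pair ((PolyTime.const no).pair PolyTime.id.fst.snd))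
      (PolyTime.nil.pair ((PolyTime.const yes).pair PolyTime.id.fst.snd)))
    (PolyTime.nil.pair (PolyTime.id.snd.pair PolyTime.id.fst.snd))

theorem polyTime_incEnd : PolyTime incEnd :=
  PolyTime.ite PolyTime.id.fst ((PolyTime.const yes).pair PolyTime.id.snd) PolyTime.id.snd

/-- The successor on binary numerals. -/
noncomputable def incData (d : Data) : Data :=
  encList (incEnd (d.toList.foldl incStep (Data.node yes Data.nil))).toList.reverse

theorem incData_encNat (n : ℕ) : incData (encNat n) = encNat (n + 1) := by
  rw [incData, encNat, toList_encList, incEnd_foldl_carry, encNat, ← incBits_bits]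
  simp

theorem polyTime_incData : PolyTime incData := by
  refine PolyTime.reverse (polyTime_incEnd.comp ?_)
  refine PolyTime.foldl_of_growth (h := fun _ => incStep)
    (polyTime₂_incStep.comp PolyTime.id.snd.fst PolyTime.id.snd.snd)
    ((PolyTime.const yes).pair PolyTime.nil) PolyTime.id (Polynomial.X + 10) fun x acc a => ?_
  have := acc.size_pos
  have h2 := acc.size_snd_le
  unfold incStep
  split_ifs <;> simp [yes, no, encBool] <;> omega

/-- The length of a list in binary. -/
theorem PolyTime.encNat_length {l : Data → Data} (hl : PolyTime l) :
    PolyTime fun x => encNat (l x).toList.length := by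
  have spec : ∀ l' : List Data,
      l'.foldl (fun acc _ => incData acc) (encNat 0) = encNat l'.length := by
    intro l'
    induction l' using List.reverseRecOn with
    | nil => rfl
    | append_singleton l' a ih => simp [List.foldl_append, ih, incData_encNat]
  obtain ⟨q, hq⟩ := hl.size_le
  have := PolyTime.foldl (h := fun _ acc _ => incData acc)
    (polyTime_incData.comp PolyTime.id.snd.fst) (PolyTime.const (encNat 0)) hl
    (4 * q + 1) (by
      intro x l' hl'
      rw [spec, encNat]
      have h1 : (encList (l'.length.bits.map encBool)).size ≤
          (l'.length.bits.map encBool).length * (3 + 1) + 1 := by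
        refine size_encList_le fun a ha => ?_
        obtain ⟨b, -, rfl⟩ := List.mem_map.1 ha
        cases b <;> simp [encBool]
      rw [List.length_map, Nat.size_eq_bits_len] at h1
      have h2 : Nat.size l'.length ≤ l'.length :=
        Nat.size_le.2 (Nat.lt_two_pow_self)
      have h3 : l'.length ≤ q.eval x.size :=
        (hl'.length_le.trans (Data.length_toList_le _)).trans (hq x)
      simp only [Polynomial.eval_add, Polynomial.eval_mul, Polynomial.eval_ofNat,
        Polynomial.eval_one]
      omega)
  simpa only [spec] using this

/-! ### The matrices of the reduction -/

/-- The least `t` with `n ≤ 16 t²`, computed by counting. -/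
def quarterRoot (n : ℕ) : ℕ := (fun t => if 16 * t ^ 2 < n then t + 1 else t)^[n] 0

theorem quarterRoot_spec (n : ℕ) :
    n ≤ 16 * quarterRoot n ^ 2 ∧ ∀ s, s < quarterRoot n → 16 * s ^ 2 < n := by
  -- Invariant of the counting: either the threshold is reached, or every round so far has
  -- incremented. After `n` rounds the second case gives `t = n`, which satisfies the bound as well.
  have key : ∀ k, let t := (fun t => if 16 * t ^ 2 < n then t + 1 else t)^[k] 0
      (n ≤ 16 * t ^ 2 ∨ t = k) ∧ ∀ s, s < t → 16 * s ^ 2 < n := by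
    intro k
    induction k with
    | zero => simp
    | succ k ih =>
      simp only [Function.iterate_succ_apply'] at ih ⊢
      generalize (fun t => if 16 * t ^ 2 < n then t + 1 else t)^[k] 0 = t at ih ⊢
      split_ifs with h
      · refine ⟨Or.inr (by omega), fun s hs => ?_⟩
        have : s ≤ t := by omega
        exact lt_of_le_of_lt (by gcongr) h
      · exact ⟨Or.inl (by omega), ih.2⟩
  refine ⟨?_, (key n).2⟩
  rcases (key n).1 with h | h
  · exact h
  · change quarterRoot n = n at h
    rw [h]
    nlinarith

theorem quarterRoot_pos {n : ℕ} (hn : 0 < n) : 0 < quarterRoot n := by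
  have := (quarterRoot_spec n).1
  rcases Nat.eq_zero_or_pos (quarterRoot n) with h | h
  · rw [h] at this; omega
  · exact h

open Classical in
/-- The matrix `3/5 I + A / (5 t)`, with `A` the signed adjacency matrix of the graph or, if `σ` is
`false`, of its complement. -/
noncomputable def graphMatrix (σ : Bool) {n : ℕ} (G : SimpleGraph (Fin n)) :
    Matrix (Fin n) (Fin n) ℚ := fun i j =>
  if i = j then 3 / 5
  else (if decide (G.Adj i j) = σ then 1 else -1) / ((5 * quarterRoot n : ℕ) : ℚ)

/-- A matrix of random signs, scaled by `1 / (4 t)`. -/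
def signMatrix (n : ℕ) {a b : ℕ} (r : Fin a × Fin b → Bool) : Matrix (Fin a) (Fin b) ℚ :=
  fun i j => (if r (i, j) then 1 else -1) / ((4 * quarterRoot n : ℕ) : ℚ)

/-- A block diagonal matrix, with rows and columns numbered consecutively. -/
def blockMatrix {n a b m N : ℕ} (hm : n + a = m) (hN : n + b = N)
    (Φ : Matrix (Fin n) (Fin n) ℚ) (Ψ : Matrix (Fin a) (Fin b) ℚ) : Matrix (Fin m) (Fin N) ℚ :=
  Matrix.reindex (finSumFinEquiv.trans (finCongr hm)) (finSumFinEquiv.trans (finCongr hN))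
    (Matrix.fromBlocks Φ 0 0 Ψ)

theorem ofFn_finSumFinEquiv_symm {α : Type*} {n a m : ℕ} (h : n + a = m) (f : Fin n ⊕ Fin a → α) :
    List.ofFn (fun i => f ((finSumFinEquiv.trans (finCongr h)).symm i)) =
      List.ofFn (fun i => f (Sum.inl i)) ++ List.ofFn (fun i => f (Sum.inr i)) := by
  subst h
  rw [← List.ofFn_fin_append]
  congr 1
  funext i
  refine Fin.addCases (fun i => ?_) (fun i => ?_) i <;> simp

theorem encMatrix_blockMatrix {n a b m N : ℕ} (hm : n + a = m) (hN : n + b = N)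
    (Φ : Matrix (Fin n) (Fin n) ℚ) (Ψ : Matrix (Fin a) (Fin b) ℚ) :
    encMatrix (blockMatrix hm hN Φ Ψ) = encList
      ((List.ofFn fun i => encList
        ((List.ofFn fun j => encRat (Φ i j)) ++ List.ofFn fun _ : Fin b => encRat 0)) ++
      List.ofFn fun i => encList
        ((List.ofFn fun _ : Fin n => encRat 0) ++ List.ofFn fun j => encRat (Ψ i j))) := by
  have h1 := ofFn_finSumFinEquiv_symm hm (fun i => encList (List.ofFn fun j =>
    encRat (Matrix.fromBlocks Φ 0 0 Ψ i ((finSumFinEquiv.trans (finCongr hN)).symm j))))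
  unfold encMatrix blockMatrix
  simp only [Matrix.reindex_apply, Matrix.submatrix_apply]
  rw [h1]
  have h2 := fun i => ofFn_finSumFinEquiv_symm hN (fun j =>
    encRat (Matrix.fromBlocks Φ 0 0 Ψ i j))
  simp only [h2]
  simp

/-! ### Programs for these matrices -/

theorem mapIdx_ofFn {α β : Type*} {n : ℕ} (f : Fin n → α) (g : ℕ → α → β) :
    (List.ofFn f).mapIdx g = List.ofFn fun i => g i (f i) := by
  apply List.ext_getElem <;> simp

open Classical in
/-- The unary representation of `quarterRoot` of the length of a list. -/
noncomputable def rootData (l : Data) : Data :=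
  l.toList.foldl (fun acc _ =>
    if encList (l.toList.drop (16 * acc.toList.length ^ 2)) = Data.nil then acc
    else Data.node Data.nil acc) Data.nil

theorem encList_eq_nil {l : List Data} : encList l = Data.nil ↔ l = [] := by
  cases l <;> simp

open Classical in
theorem length_toList_rootData (l : Data) :
    (rootData l).toList.length = quarterRoot l.toList.length := by
  unfold rootData quarterRoot
  rw [foldl_iterate (fun acc : Data =>
    if encList (l.toList.drop (16 * acc.toList.length ^ 2)) = Data.nil then acc
    else Data.node Data.nil acc)]
  generalize hm : l.toList.length = m
  have key : ∀ k, ((fun acc : Data =>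
      if encList (l.toList.drop (16 * acc.toList.length ^ 2)) = Data.nil then acc
      else Data.node Data.nil acc)^[k] Data.nil).toList.length =
      (fun t => if 16 * t ^ 2 < m then t + 1 else t)^[k] 0 := by
    intro k
    induction k with
    | zero => rfl
    | succ k ih =>
      rw [Function.iterate_succ_apply', Function.iterate_succ_apply', ← ih]
      simp only [encList_eq_nil, List.drop_eq_nil_iff, hm]
      split_ifs <;> first | rfl | omega
  exact key m

theorem iterate_drop (m k : ℕ) (d : Data) :
    (fun s : Data => encList (s.toList.drop m))^[k] d = encList (d.toList.drop (k * m)) := by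
  induction k with
  | zero => simp
  | succ k ih => rw [Function.iterate_succ_apply', ih]; simp; ring_nf

open Classical in
theorem polyTime_rootData : PolyTime rootData := by
  -- No multiplication is programmed: dropping `16 t` elements `t` times drops `16 t ^ 2`. The list
  -- that remains is empty exactly if the comparison `16 t ^ 2 < n` fails.
  have h0 : PolyTime fun z => encList (z.snd.toList.drop (16 * z.fst.toList.length ^ 2)) := by
    have := PolyTime.foldl_of_growth
      (h := fun z s _ =>
        encList (s.toList.drop (encList (List.replicate 16 z.fst.toList).flatten).toList.length))
      (PolyTime.drop_length (PolyTime.id.fst.fst.flatten_replicate 16) PolyTime.id.snd.fst)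
      PolyTime.id.snd PolyTime.id.fst 0
      (by intro x acc a; simpa using acc.size_encList_drop_le _)
    convert this using 2 with z
    rw [foldl_iterate (fun s : Data => encList (s.toList.drop
      (encList (List.replicate 16 z.fst.toList).flatten).toList.length)), iterate_drop]
    congr 2
    simp
    ring
  refine PolyTime.foldl_of_growth
    (h := fun l acc _ => if encList (l.toList.drop (16 * acc.toList.length ^ 2)) = Data.nil
      then acc else Data.node Data.nil acc)
    (PolyTime.ite (h0.comp (PolyTime.id.snd.fst.pair PolyTime.id.fst))
      (PolyTime.nil.pair PolyTime.id.snd.fst) PolyTime.id.snd.fst) PolyTime.nil PolyTime.id 2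
    fun x acc a => ?_
  split_ifs <;> simp
  omega

/-- The fraction `± 1 / (c t)`, with `t` given in unary. -/
def unitFrac (c : ℕ) (s : Bool) (t : Data) : Data :=
  Data.node (Data.node (encBool s) (encNat 1))
    (encNat (encList (List.replicate c t.toList).flatten).toList.length)

theorem polyTime_unitFrac (c : ℕ) (s : Bool) : PolyTime (unitFrac c s) :=
  (PolyTime.const _).pair (PolyTime.id.flatten_replicate c).encNat_length

/-- A numerator of ±1 is automatically in lowest terms, so no gcd has to be computed. The sign bit
`true` stands for a negative number. -/
theorem unitFrac_eq {c k : ℕ} (hc : 0 < c) (s : Bool) {t : Data} (ht : t.toList.length = k)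
    (hk : 0 < k) :
    unitFrac c s t = encRat ((if s then -1 else 1) / ((c * k : ℕ) : ℚ)) := by
  have hck : 0 < c * k := by positivity
  have h : (encList (List.replicate c t.toList).flatten).toList.length = c * k := by simp [ht]
  unfold unitFrac
  rw [h]
  cases s with
  | false =>
    simp only [Bool.false_eq_true, if_false, one_div, encRat, Rat.inv_natCast_num_of_pos hck,
      Rat.inv_natCast_den_of_pos hck]
    rfl
  | true =>
    simp only [if_true, neg_div, one_div, encRat, Rat.neg_num, Rat.neg_den,
      Rat.inv_natCast_num_of_pos hck, Rat.inv_natCast_den_of_pos hck]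
    rfl

open Classical in
/-- Entry of the graph matrix: `d` tells whether it lies on the diagonal, `a` is the entry of the
adjacency matrix. -/
noncomputable def graphEntry (σ : Bool) (G d a : Data) : Data :=
  if d = Data.nil then
    if a = Data.nil then unitFrac 5 σ (rootData G) else unitFrac 5 (!σ) (rootData G)
  else encRat (3 / 5)

theorem polyTime₃_graphEntry (σ : Bool) : PolyTime₃ (graphEntry σ) :=
  PolyTime.ite PolyTime.id.snd.fst (PolyTime.const _)
    (PolyTime.ite PolyTime.id.snd.snd
      ((polyTime_unitFrac 5 (!σ)).comp (polyTime_rootData.comp PolyTime.id.fst))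
      ((polyTime_unitFrac 5 σ).comp (polyTime_rootData.comp PolyTime.id.fst)))

open Classical in
/-- Entry of the sign matrix. -/
noncomputable def signEntry (G a : Data) : Data :=
  if a = Data.nil then unitFrac 4 true (rootData G) else unitFrac 4 false (rootData G)

theorem polyTime₂_signEntry : PolyTime₂ signEntry :=
  PolyTime.ite PolyTime.id.snd
    ((polyTime_unitFrac 4 false).comp (polyTime_rootData.comp PolyTime.id.fst))
    ((polyTime_unitFrac 4 true).comp (polyTime_rootData.comp PolyTime.id.fst))

/-- The list of `c` copies of the rows of the graph, of which only the length matters. -/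
def copies (c : ℕ) (x : Data) : Data := encList (List.replicate c x.fst.toList).flatten

theorem polyTime_copies (c : ℕ) : PolyTime (copies c) := PolyTime.id.fst.flatten_replicate c

/-- A row of the graph matrix: `marker` is a list whose only true element is on the diagonal. -/
noncomputable def graphRow (σ : Bool) (c : ℕ) (x marker row : Data) : Data :=
  encList (row.toList.mapIdx (fun j a => graphEntry σ x.fst (Data.snd^[j] marker).fst a) ++
    (copies c x).toList.map fun _ => encRat 0)

/-- A row of the sign matrix: the signs are the first elements of `coins`. -/
noncomputable def signRow (c : ℕ) (x coins : Data) : Data :=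
  encList (x.fst.toList.map (fun _ => encRat 0) ++
    (copies c x).toList.mapIdx fun j _ => signEntry x.fst (Data.snd^[j] coins).fst)

/-- The whole matrix, computed from a graph and a sequence of coin tosses. -/
noncomputable def matrixData (σ : Bool) (p c : ℕ) (x : Data) : Data :=
  encList (x.fst.toList.mapIdx
      (fun i row => graphRow σ c x ((Data.node Data.nil)^[i] (Data.node yes Data.nil)) row) ++
    (copies p x).toList.mapIdx fun i _ => signRow c x
      ((fun s => encList (s.toList.drop (copies c x).toList.length))^[i] x.snd))

theorem size_iterate_snd_le (k : ℕ) (d : Data) : (Data.snd^[k] d).size ≤ d.size := by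
  rw [iterate_snd]; exact d.size_encList_drop_le k

theorem polyTime₃_graphRow (σ : Bool) (c : ℕ) : PolyTime₃ (graphRow σ c) := by
  have h1 := PolyTime.mapIdx_iterate
    (g := fun z s a => graphEntry σ z.fst.fst s.fst a) (σ := fun _ s => s.snd)
    (s := fun z => z.snd.fst) (l := fun z => z.snd.snd)
    ((polyTime₃_graphEntry σ).comp PolyTime.id.fst.fst.fst PolyTime.id.snd.fst.fst
      PolyTime.id.snd.snd) PolyTime.id.snd.snd PolyTime.id.snd.fst PolyTime.id.snd.snd
    Polynomial.X (by
      intro x i _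
      refine (size_iterate_snd_le i _).trans ?_
      rw [Polynomial.eval_X]
      exact (Data.size_fst_le _).trans (Data.size_snd_le _))
  have h2 := PolyTime.map (g := fun _ _ => encRat 0) (PolyTime.const _)
    ((polyTime_copies c).comp PolyTime.id.fst)
  have := h1.append h2
  simp only [toList_encList] at this
  exact this

theorem polyTime₂_signRow (c : ℕ) : PolyTime₂ (signRow c) := by
  have h1 := PolyTime.mapIdx_iterate
    (g := fun z s _ => signEntry z.fst.fst s.fst) (σ := fun _ s => s.snd)
    (s := fun z => z.snd) (l := fun z => copies c z.fst)
    (polyTime₂_signEntry.comp PolyTime.id.fst.fst.fst PolyTime.id.snd.fst.fst)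
    PolyTime.id.snd.snd PolyTime.id.snd ((polyTime_copies c).comp PolyTime.id.fst)
    Polynomial.X (by
      intro x i _
      refine (size_iterate_snd_le i _).trans ?_
      rw [Polynomial.eval_X]
      exact Data.size_snd_le _)
  have h2 := PolyTime.map (g := fun _ _ => encRat 0) (PolyTime.const _) PolyTime.id.fst.fst
  have := h2.append h1
  simp only [toList_encList] at this
  exact this

theorem polyTime_matrixData (σ : Bool) (p c : ℕ) : PolyTime (matrixData σ p c) := by
  have hs : ∀ i, ((Data.node Data.nil)^[i] (Data.node yes Data.nil)).size = 2 * i + 5 := by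
    intro i
    induction i with
    | zero => rfl
    | succ i ih => rw [Function.iterate_succ_apply', size_node, ih, size_nil]; ring
  have h1 := PolyTime.mapIdx_iterate
    (g := fun x s a => graphRow σ c x s a) (σ := fun _ s => Data.node Data.nil s)
    (s := fun _ => Data.node yes Data.nil) (l := fun x => x.fst)
    ((polyTime₃_graphRow σ c).comp PolyTime.id.fst PolyTime.id.snd.fst PolyTime.id.snd.snd)
    (PolyTime.nil.pair PolyTime.id.snd) (PolyTime.const _) PolyTime.id.fst
    (2 * Polynomial.X + 5) (by
      intro x i hi
      rw [hs]
      have := hi.trans ((Data.length_toList_le _).trans x.size_fst_le)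
      simp
      omega)
  have h2 := PolyTime.mapIdx_iterate
    (g := fun x s _ => signRow c x s)
    (σ := fun x s => encList (s.toList.drop (copies c x).toList.length))
    (s := fun x => x.snd) (l := fun x => copies p x)
    ((polyTime₂_signRow c).comp PolyTime.id.fst PolyTime.id.snd.fst)
    (PolyTime.drop_length ((polyTime_copies c).comp PolyTime.id.fst) PolyTime.id.snd)
    PolyTime.id.snd (polyTime_copies p) Polynomial.X (by
      intro x i _
      rw [iterate_drop, Polynomial.eval_X]
      exact (Data.size_encList_drop_le _ _).trans x.size_snd_le)
  have := h1.append h2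
  simp only [toList_encList] at this
  exact this

theorem fst_iterate_snd_marker (i j : ℕ) :
    (Data.snd^[j] ((Data.node Data.nil)^[i] (Data.node yes Data.nil))).fst =
      if i = j then yes else Data.nil := by
  have hnil : ∀ j, Data.snd^[j] Data.nil = Data.nil := fun j => Function.iterate_fixed rfl j
  induction i generalizing j with
  | zero => cases j with
    | zero => rfl
    | succ j => simp [Function.iterate_succ_apply, hnil, Data.fst]
  | succ i ih =>
    rw [Function.iterate_succ_apply']
    cases j with
    | zero => simp
    | succ j =>
      rw [Function.iterate_succ_apply, snd_node, ih]
      simp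

theorem fst_encList_ofFn_drop {L : ℕ} (f : Fin L → Data) (i : Fin L) :
    (encList ((List.ofFn f).drop i)).fst = f i := by
  rw [List.drop_eq_getElem_cons (by simp)]
  simp

theorem graphEntry_eq (σ : Bool) {n : ℕ} (G : SimpleGraph (Fin n)) (i j : Fin n) :
    graphEntry σ (encGraph G) (if (i : ℕ) = j then yes else Data.nil)
      (open Classical in encBool (decide (G.Adj i j))) = encRat (graphMatrix σ G i j) := by
  have hlen : (encGraph G).toList.length = n := by simp [encGraph]
  have ht := length_toList_rootData (encGraph G)
  rw [hlen] at ht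
  have hpos : 0 < quarterRoot n := quarterRoot_pos i.pos
  unfold graphEntry graphMatrix
  rw [unitFrac_eq (by norm_num) σ ht hpos, unitFrac_eq (by norm_num) (!σ) ht hpos]
  by_cases h : i = j
  · simp [h]
  · have h' : (i : ℕ) ≠ j := fun e => h (Fin.ext e)
    by_cases ha : G.Adj i j <;> cases σ <;> simp [h, h', ha, encBool]

theorem signEntry_eq {n a b : ℕ} (hn : 0 < n) (G : SimpleGraph (Fin n)) (r : Fin a × Fin b → Bool)
    (i : Fin a) (j : Fin b) :
    signEntry (encGraph G) (encBool (r (i, j))) = encRat (signMatrix n r i j) := by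
  have hlen : (encGraph G).toList.length = n := by simp [encGraph]
  have ht := length_toList_rootData (encGraph G)
  rw [hlen] at ht
  have hpos : 0 < quarterRoot n := quarterRoot_pos hn
  unfold signEntry signMatrix
  rw [unitFrac_eq (by norm_num) true ht hpos, unitFrac_eq (by norm_num) false ht hpos]
  cases r (i, j) <;> simp [encBool]

/-- The coin tosses, arranged in a matrix. -/
def coinMatrix {a b L : ℕ} (hL : a * b = L) (r : Fin L → Bool) : Fin a × Fin b → Bool :=
  fun ij => r (Fin.cast hL (finProdFinEquiv ij))

theorem matrixData_eq (σ : Bool) {n p c m N L : ℕ} (hm : n + p * n = m) (hN : n + c * n = N)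
    (hL : p * n * (c * n) = L) (G : SimpleGraph (Fin n)) (r : Fin L → Bool) :
    matrixData σ p c (Data.node (encGraph G) (encCoins r)) =
      encMatrix (blockMatrix hm hN (graphMatrix σ G) (signMatrix n (coinMatrix hL r))) := by
  have hlen : (encGraph G).toList.length = n := by simp [encGraph]
  have hcop : ∀ c, (copies c (Data.node (encGraph G) (encCoins r))).toList.length = c * n := by
    intro c; simp [copies, hlen]
  have mapIdx_const : ∀ (l : List Data) (k : ℕ) (f : ℕ → Data), l.length = k →
      l.mapIdx (fun i _ => f i) = List.ofFn fun i : Fin k => f i := by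
    rintro l k f rfl
    apply List.ext_getElem <;> simp
  have map_const : ∀ (l : List Data) (k : ℕ) (d : Data), l.length = k →
      l.map (fun _ => d) = List.ofFn fun _ : Fin k => d := by
    rintro l k d rfl
    apply List.ext_getElem <;> simp
  rw [encMatrix_blockMatrix]
  unfold matrixData
  rw [mapIdx_const _ _ (fun i => signRow c _ _) (hcop p)]
  congr 2
  · have hG : (encGraph G).toList = List.ofFn fun i => encList (List.ofFn fun j =>
        (open Classical in encBool (decide (G.Adj i j)))) := by simp [encGraph]
    rw [fst_node, hG, mapIdx_ofFn]
    congr 1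
    funext i
    unfold graphRow
    rw [map_const _ _ _ (hcop c), toList_encList, mapIdx_ofFn]
    congr 3
    funext j
    rw [fst_iterate_snd_marker]
    exact graphEntry_eq σ G i j
  · congr 1
    funext i
    unfold signRow
    rw [fst_node, snd_node, map_const _ _ _ hlen, mapIdx_const _ _ (fun j => signEntry _ _) (hcop c)]
    congr 3
    funext j
    have hn : 0 < n := by
      rcases Nat.eq_zero_or_pos n with h | h
      · subst h; exact absurd i.pos (by simp)
      · exact h
    -- `finProdFinEquiv` numbers the position `(i, j)` by `j + c * n * i`. This is what the program
    -- reads: it skips `i` rows of `c * n` coins, and then `j` more coins.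
    rw [hcop, iterate_drop, iterate_snd, ← signEntry_eq hn G]
    congr 1
    have := fst_encList_ofFn_drop (fun i => encBool (r i)) (Fin.cast hL (finProdFinEquiv (i, j)))
    simp only [coinMatrix]
    rw [← this]
    simp [encCoins, finProdFinEquiv]
    congr 3
    ring

/-! ### Concentration of quadratic functions of random signs -/

/-- The sign `± 1` of a coin toss. -/
def sgn (b : Bool) : ℝ := if b then 1 else -1

/-- Cauchy–Schwarz on the support. It is applied to the change caused by a single sign, which
affects at most two summands. -/
theorem sq_sum_le_two_mul {R : Type*} [Fintype R] (f : R → ℝ)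
    (h : (Finset.univ.filter fun i => f i ≠ 0).card ≤ 2) :
    (∑ i, f i) ^ 2 ≤ 2 * ∑ i, f i ^ 2 := by
  have h1 : ∑ i, f i = ∑ i ∈ Finset.univ.filter fun i => f i ≠ 0, f i := by
    rw [Finset.sum_filter_ne_zero]
  have h2 : ∑ i ∈ Finset.univ.filter (fun i => f i ≠ 0), f i ^ 2 ≤ ∑ i, f i ^ 2 :=
    Finset.sum_le_sum_of_subset_of_nonneg (Finset.filter_subset _ _) fun i _ _ => sq_nonneg _
  have h3 := sq_sum_le_card_mul_sum_sq (s := Finset.univ.filter fun i => f i ≠ 0) (f := f)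
  have h4 : 0 ≤ ∑ i ∈ Finset.univ.filter (fun i => f i ≠ 0), f i ^ 2 :=
    Finset.sum_nonneg fun i _ => sq_nonneg _
  have h5 : ((Finset.univ.filter fun i => f i ≠ 0).card : ℝ) ≤ 2 := by exact_mod_cast h
  rw [h1]
  nlinarith

/-- The average over one random sign, from cosh b ≤ exp(b² / 2). -/
theorem exp_add_exp_neg_le (a b : ℝ) :
    Real.exp (a + b) + Real.exp (a - b) ≤ 2 * Real.exp (a + b ^ 2 / 2) := by
  have h := Real.cosh_le_exp_half_sq b
  rw [Real.cosh_eq] at h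
  rw [Real.exp_add, sub_eq_add_neg, Real.exp_add, Real.exp_add]
  have := Real.exp_pos a
  nlinarith

/-- The moment generating function of a sum of squares of affine functions of random signs, each
sign occurring in at most two of the summands. -/
theorem sum_exp_sum_sq_le {R : Type*} [Fintype R] (s : ℝ) (E : Type*) [Fintype E] [DecidableEq E]
    (c : R → E → ℝ) (z : R → ℝ) (hc : ∀ e, (Finset.univ.filter fun i => c i e ≠ 0).card ≤ 2)
    (hs : ∀ i, |s| * ∑ e, c i e ^ 2 ≤ 1 / 20) :
    ∑ ω : E → Bool, Real.exp (s * ∑ i, (z i + ∑ e, c i e * sgn (ω e)) ^ 2) ≤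
      2 ^ Fintype.card E * Real.exp (∑ i, (s + 8 * s ^ 2 * ∑ e, c i e ^ 2) *
        (z i ^ 2 + ∑ e, c i e ^ 2)) := by
  -- Induction on the set of signs. The offsets `z` must vary in it, because a sign whose value is
  -- fixed is absorbed into them.
  let p : ∀ (E : Type _) [Fintype E], Prop := fun E _ =>
    let := Classical.decEq E
    ∀ (c : R → E → ℝ) (z : R → ℝ), (∀ e, (Finset.univ.filter fun i => c i e ≠ 0).card ≤ 2) →
      (∀ i, |s| * ∑ e, c i e ^ 2 ≤ 1 / 20) →
      ∑ ω : E → Bool, Real.exp (s * ∑ i, (z i + ∑ e, c i e * sgn (ω e)) ^ 2) ≤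
        2 ^ Fintype.card E * Real.exp (∑ i, (s + 8 * s ^ 2 * ∑ e, c i e ^ 2) *
          (z i ^ 2 + ∑ e, c i e ^ 2))
  have main : p E := by
    refine Fintype.induction_empty_option (P := p) ?_ ?_ ?_ E
    · intro α β _ f ih
      let : Fintype α := Fintype.ofEquiv β f.symm
      intro c z hc hs
      have := ih (fun i e => c i (f e)) z (fun e => hc (f e))
        (fun i => by rw [Equiv.sum_comp f fun e => c i e ^ 2]; exact hs i)
      have hsq : ∀ i, ∑ e, c i (f e) ^ 2 = ∑ e, c i e ^ 2 := fun i =>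
        Equiv.sum_comp f fun e => c i e ^ 2
      rw [Fintype.card_congr f] at this
      simp only [hsq] at this
      refine le_trans (le_of_eq ?_) this
      let := Classical.decEq α
      let := Classical.decEq β
      refine (Fintype.sum_equiv (f.arrowCongr (Equiv.refl Bool)) _ _ fun ω => ?_).symm
      congr 2
      refine Finset.sum_congr rfl fun i _ => ?_
      rw [← Equiv.sum_comp f fun e => c i e * _]
      simp
    · intro c z _ _
      simp [Finset.mul_sum]
    · intro α _ ih c z hc hs
      let := Classical.decEq α
      simp only [Fintype.sum_option] at hs
      have hs' : ∀ i, |s| * ∑ e, c i (some e) ^ 2 ≤ 1 / 20 := fun i =>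
        le_trans (mul_le_mul_of_nonneg_left (by nlinarith [sq_nonneg (c i none)]) (abs_nonneg s))
          (hs i)
      have ih' := fun b : Bool => ih (fun i e => c i (some e)) (fun i => z i + c i none * sgn b)
        (fun e => hc (some e)) hs'
      set ρ : R → ℝ := fun i => ∑ e, c i (some e) ^ 2 with hρ
      have hρ0 : ∀ i, 0 ≤ ρ i := fun i => Finset.sum_nonneg fun e _ => sq_nonneg _
      have split : ∑ ω : Option α → Bool,
          Real.exp (s * ∑ i, (z i + ∑ e, c i e * sgn (ω e)) ^ 2) =
          ∑ b : Bool, ∑ ω : α → Bool, Real.exp (s * ∑ i,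
            ((z i + c i none * sgn b) + ∑ e, c i (some e) * sgn (ω e)) ^ 2) := by
        rw [← Fintype.sum_prod_type']
        refine Fintype.sum_equiv (Equiv.piOptionEquivProd (β := fun _ => Bool)) _ _ fun ω => ?_
        simp only [Fintype.sum_option, Equiv.piOptionEquivProd_apply]
        congr 2
        refine Finset.sum_congr rfl fun i _ => ?_
        ring
      refine le_trans (le_of_eq (b := ∑ ω : Option α → Bool,
          Real.exp (s * ∑ i, (z i + ∑ e, c i e * sgn (ω e)) ^ 2)) (by convert rfl)) ?_
      rw [split, Fintype.sum_bool]
      refine (add_le_add (ih' true) (ih' false)).trans ?_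
      simp only [Fintype.sum_option, sgn, if_true, Bool.false_eq_true, if_false]
      -- The two values of the last sign give the exponents `A + B` and `A - B`, with `B` linear in
      -- that sign.
      set A : ℝ := ∑ i, (s + 8 * s ^ 2 * ρ i) * (z i ^ 2 + c i none ^ 2 + ρ i) with hA
      set B : ℝ := ∑ i, 2 * ((s + 8 * s ^ 2 * ρ i) * z i * c i none) with hB
      have e1 : ∑ i, (s + 8 * s ^ 2 * ρ i) * ((z i + c i none * 1) ^ 2 + ρ i) = A + B := by
        rw [hA, hB, ← Finset.sum_add_distrib]
        exact Finset.sum_congr rfl fun i _ => by ring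
      have e2 : ∑ i, (s + 8 * s ^ 2 * ρ i) * ((z i + c i none * -1) ^ 2 + ρ i) = A - B := by
        rw [hA, hB, ← Finset.sum_sub_distrib]
        exact Finset.sum_congr rfl fun i _ => by ring
      rw [e1, e2, ← mul_add, Fintype.card_option, pow_succ, mul_assoc]
      refine mul_le_mul_of_nonneg_left ?_ (by positivity)
      refine (exp_add_exp_neg_le A B).trans ?_
      refine mul_le_mul_of_nonneg_left (Real.exp_le_exp.2 ?_) (by norm_num)
      have hB2 : B ^ 2 ≤ 2 * ∑ i, (2 * ((s + 8 * s ^ 2 * ρ i) * z i * c i none)) ^ 2 := by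
        refine sq_sum_le_two_mul _ (le_trans (Finset.card_le_card ?_) (hc none))
        intro i hi
        simp only [Finset.mem_filter, Finset.mem_univ, true_and] at hi ⊢
        intro h0
        exact hi (by rw [h0]; ring)
      -- The correction `8 s ^ 2` is chosen for this step. As `8 |s| ρ ≤ 2 / 5`, the coefficient is
      -- at most `7 / 5 |s|`, whose square is below `2 s ^ 2`. The cost `4 * 2 s ^ 2` of the new
      -- sign is then paid by the growth of the correction when `c i none ^ 2` joins `ρ i`.
      have hterm : ∑ i, (s + 8 * s ^ 2 * ρ i) * (z i ^ 2 + c i none ^ 2 + ρ i) +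
          ∑ i, (2 * ((s + 8 * s ^ 2 * ρ i) * z i * c i none)) ^ 2 ≤
          ∑ i, (s + 8 * s ^ 2 * (c i none ^ 2 + ρ i)) * (z i ^ 2 + (c i none ^ 2 + ρ i)) := by
        rw [← Finset.sum_add_distrib]
        refine Finset.sum_le_sum fun i _ => ?_
        have h1 : (s + 8 * s ^ 2 * ρ i) ^ 2 ≤ 2 * s ^ 2 := by
          have h2 : |s + 8 * s ^ 2 * ρ i| ≤ |s| * (7 / 5) := by
            refine (abs_add_le _ _).trans ?_
            rw [abs_of_nonneg (by have := hρ0 i; positivity : (0 : ℝ) ≤ 8 * s ^ 2 * ρ i), ← sq_abs s]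
            have := mul_le_mul_of_nonneg_left (hs' i) (abs_nonneg s)
            change |s| * (|s| * ρ i) ≤ _ at this
            nlinarith
          have h3 := pow_le_pow_left₀ (abs_nonneg _) h2 2
          rw [sq_abs, mul_pow, sq_abs] at h3
          nlinarith [sq_nonneg s]
        have h4 : (2 * ((s + 8 * s ^ 2 * ρ i) * z i * c i none)) ^ 2 ≤
            4 * (2 * s ^ 2) * (z i ^ 2 * c i none ^ 2) := by
          have := mul_le_mul_of_nonneg_right h1 (by positivity : 0 ≤ z i ^ 2 * c i none ^ 2)
          nlinarith
        have h5 : 0 ≤ 8 * s ^ 2 * c i none ^ 2 * (c i none ^ 2 + ρ i) := by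
          have := hρ0 i; positivity
        nlinarith
      linarith
  have := main c z hc hs
  convert this

/-- Markov's inequality for exp(X), in terms of counting. -/
theorem card_filter_mul_exp_le {Ω : Type*} [Fintype Ω] (X : Ω → ℝ) (v : ℝ) :
    ((Finset.univ.filter fun ω => v ≤ X ω).card : ℝ) * Real.exp v ≤ ∑ ω, Real.exp (X ω) := by
  calc ((Finset.univ.filter fun ω => v ≤ X ω).card : ℝ) * Real.exp v
      = ∑ ω ∈ Finset.univ.filter (fun ω => v ≤ X ω), Real.exp v := by
        rw [Finset.sum_const, nsmul_eq_mul]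
    _ ≤ ∑ ω ∈ Finset.univ.filter (fun ω => v ≤ X ω), Real.exp (X ω) :=
        Finset.sum_le_sum fun ω hω => Real.exp_le_exp.2 (Finset.mem_filter.1 hω).2
    _ ≤ ∑ ω, Real.exp (X ω) :=
        Finset.sum_le_sum_of_subset_of_nonneg (Finset.filter_subset _ _)
          fun ω _ _ => (Real.exp_pos _).le

/-- Tail bound for a sum of squares of affine functions of random signs, each sign occurring in at
most two of the summands. -/
theorem card_deviation_le {R E : Type*} [Fintype R] [Fintype E] [DecidableEq E]
    (c : R → E → ℝ) (z : R → ℝ) (hc : ∀ e, (Finset.univ.filter fun i => c i e ≠ 0).card ≤ 2)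
    {r u M : ℝ} (hr : 0 < r) (hcr : ∀ i, ∑ e, c i e ^ 2 ≤ r) (hu : 0 < u) (hu1 : u ≤ 1)
    (hM : M = ∑ i, (z i ^ 2 + ∑ e, c i e ^ 2)) (hM2 : M ≤ 2) :
    ((Finset.univ.filter fun ω : E → Bool =>
      u ≤ |∑ i, (z i + ∑ e, c i e * sgn (ω e)) ^ 2 - M|).card : ℝ) ≤
      2 ^ Fintype.card E * (2 * Real.exp (-(u ^ 2 / (64 * r)))) := by
  set X : (E → Bool) → ℝ := fun ω => ∑ i, (z i + ∑ e, c i e * sgn (ω e)) ^ 2 with hX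
  -- This `|s|` minimises `16 s ^ 2 r - |s| u`, the minimum being `-u ^ 2 / (64 r)`. The two signs
  -- of `s` give the two tails, and `u ≤ 1` ensures `|s| r ≤ 1 / 32`, within the range of the moment
  -- bound.
  have one : ∀ s : ℝ, |s| = u / (32 * r) →
      ((Finset.univ.filter fun ω : E → Bool => s * M + |s| * u ≤ s * X ω).card : ℝ) ≤
        2 ^ Fintype.card E * Real.exp (-(u ^ 2 / (64 * r))) := by
    intro s hs
    have h1 := sum_exp_sum_sq_le s E c z hc (fun i => by
      rw [hs]
      calc u / (32 * r) * ∑ e, c i e ^ 2 ≤ u / (32 * r) * r :=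
            mul_le_mul_of_nonneg_left (hcr i) (by positivity)
        _ = u / 32 := by field_simp
        _ ≤ 1 / 20 := by linarith)
    have h2 := (card_filter_mul_exp_le (fun ω => s * X ω) (s * M + |s| * u)).trans h1
    have h3 : ∑ i, (s + 8 * s ^ 2 * ∑ e, c i e ^ 2) * (z i ^ 2 + ∑ e, c i e ^ 2) ≤
        s * M + 16 * s ^ 2 * r := by
      calc ∑ i, (s + 8 * s ^ 2 * ∑ e, c i e ^ 2) * (z i ^ 2 + ∑ e, c i e ^ 2)
          ≤ ∑ i, (s + 8 * s ^ 2 * r) * (z i ^ 2 + ∑ e, c i e ^ 2) := by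
            refine Finset.sum_le_sum fun i _ => mul_le_mul_of_nonneg_right ?_ ?_
            · have := mul_le_mul_of_nonneg_left (hcr i) (by positivity : 0 ≤ 8 * s ^ 2)
              linarith
            · have := Finset.sum_nonneg fun e (_ : e ∈ Finset.univ) => sq_nonneg (c i e)
              positivity
        _ = s * M + 8 * s ^ 2 * r * M := by rw [← Finset.mul_sum, ← hM]; ring
        _ ≤ s * M + 16 * s ^ 2 * r := by
            have := mul_le_mul_of_nonneg_left hM2 (by positivity : 0 ≤ 8 * s ^ 2 * r)
            linarith
    have h4 : s * M + 16 * s ^ 2 * r = (s * M + |s| * u) + -(u ^ 2 / (64 * r)) := by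
      rw [← sq_abs s, hs]
      field_simp
      ring
    rw [h4] at h3
    have h5 := mul_le_mul_of_nonneg_left (Real.exp_le_exp.2 h3)
      (by positivity : (0 : ℝ) ≤ 2 ^ Fintype.card E)
    rw [Real.exp_add] at h5
    have h6 := h2.trans h5
    refine le_of_mul_le_mul_right (h6.trans (le_of_eq ?_)) (Real.exp_pos (s * M + |s| * u))
    ring
  have hpos : 0 < u / (32 * r) := by positivity
  have h1 := one (u / (32 * r)) (abs_of_pos hpos)
  have h2 := one (-(u / (32 * r))) (by rw [abs_neg, abs_of_pos hpos])
  rw [abs_of_pos hpos] at h1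
  rw [abs_neg, abs_of_pos hpos] at h2
  have hsub : (Finset.univ.filter fun ω : E → Bool => u ≤ |X ω - M|) ⊆
      (Finset.univ.filter fun ω : E → Bool =>
        u / (32 * r) * M + u / (32 * r) * u ≤ u / (32 * r) * X ω) ∪
      (Finset.univ.filter fun ω : E → Bool =>
        -(u / (32 * r)) * M + u / (32 * r) * u ≤ -(u / (32 * r)) * X ω) := by
    intro ω hω
    simp only [Finset.mem_union, Finset.mem_filter, Finset.mem_univ, true_and] at hω ⊢
    rcases le_abs.1 hω with h | h
    · left; have := mul_le_mul_of_nonneg_left h hpos.le; linarith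
    · right; have := mul_le_mul_of_nonneg_left h hpos.le; linarith
  have h3 := (Finset.card_le_card hsub).trans (Finset.card_union_le _ _)
  have h4 := (Nat.cast_le (α := ℝ)).2 h3
  rw [Nat.cast_add] at h4
  linarith

/-! ### From a grid to all sparse vectors -/

open Classical in
/-- The restricted isometry property for real vectors. -/
def RealRIP {R C : Type*} [Fintype R] [Fintype C] (Φ : R → C → ℝ) (k : ℕ) (δ : ℝ) : Prop :=
  ∀ x : C → ℝ, (Finset.univ.filter fun j => x j ≠ 0).card ≤ k →
    |∑ i, (∑ j, Φ i j * x j) ^ 2 - ∑ j, x j ^ 2| ≤ δ * ∑ j, x j ^ 2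

open Classical in
/-- The vector with coordinates in `K⁻¹ ℤ` that is described by a list of at most `k` positions and
values. -/
noncomputable def gridVector {C : Type*} {k K : ℕ} (f : Fin k → C × Fin (2 * K + 1)) (j : C) : ℝ :=
  if h : ∃ l, (f l).1 = j then (((f h.choose).2 : ℕ) - (K : ℝ)) / K else 0

/-- Slots beyond the size of the support repeat positions of the support with the same values, so
the choice made in `gridVector` among repetitions is harmless. A nonzero coordinate is required so
that there is a position to repeat. -/
theorem exists_gridVector_eq {C : Type*} [Fintype C] [DecidableEq C] {k K : ℕ} (v : C → ℤ)
    (hv : ∀ j, |v j| ≤ K) (hk : (Finset.univ.filter fun j => v j ≠ 0).card ≤ k)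
    (hne : ∃ j, v j ≠ 0) :
    ∃ f : Fin k → C × Fin (2 * K + 1), ∀ j, gridVector f j = (v j : ℝ) / K := by
  set T := Finset.univ.filter fun j => v j ≠ 0 with hT
  obtain ⟨j₀, hj₀⟩ := hne
  have hj₀T : j₀ ∈ T := by simp [hT, hj₀]
  have emb : Nonempty (T ↪ Fin k) := by
    rw [Function.Embedding.nonempty_iff_card_le]
    simpa using hk
  obtain ⟨φ⟩ := emb
  have hnon : Nonempty T := ⟨⟨j₀, hj₀T⟩⟩
  let g : Fin k → C := fun l => (Function.invFun φ l : T)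
  have hval : ∀ j, (v j + K).toNat < 2 * K + 1 := fun j => by
    have := abs_le.1 (hv j); omega
  refine ⟨fun l => (g l, ⟨(v (g l) + K).toNat, hval _⟩), fun j => ?_⟩
  unfold gridVector
  by_cases h : ∃ l, g l = j
  · rw [dif_pos h]
    have e := h.choose_spec
    simp only [e]
    congr 1
    have h1 : 0 ≤ v j + K := by have := abs_le.1 (hv j); omega
    have h2 : (((v j + K).toNat : ℤ) : ℝ) = ((v j + K : ℤ) : ℝ) := by
      rw [Int.toNat_of_nonneg h1]
    push_cast at h2
    rw [h2]
    ring
  · rw [dif_neg h]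
    have : v j = 0 := by
      by_contra h0
      have hj : j ∈ T := by simp [hT, h0]
      exact h ⟨φ ⟨j, hj⟩, by simp [g, Function.leftInverse_invFun φ.injective ⟨j, hj⟩]⟩
    simp [this]

/-- Rounding towards zero to a multiple of `1 / K`. -/
theorem exists_round {K : ℕ} (hK : 0 < K) {y : ℝ} (hy : |y| ≤ 1) :
    ∃ v : ℤ, |v| ≤ K ∧ |(v : ℝ) / K| ≤ |y| ∧ |y - v / K| ≤ 1 / K ∧ (v ≠ 0 → y ≠ 0) := by
  have hK' : (0 : ℝ) < K := by exact_mod_cast hK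
  have nonneg : ∀ y : ℝ, 0 ≤ y → y ≤ 1 →
      ∃ v : ℤ, |v| ≤ K ∧ |(v : ℝ) / K| ≤ |y| ∧ |y - v / K| ≤ 1 / K ∧ (v ≠ 0 → y ≠ 0) := by
    intro y h0 h1
    have f0 : 0 ≤ ⌊K * y⌋ := Int.floor_nonneg.2 (by positivity)
    have f0' : (0 : ℝ) ≤ ⌊K * y⌋ := by exact_mod_cast f0
    have f1 := Int.floor_le (K * y)
    have f2 := (Int.lt_floor_add_one (K * y)).le
    refine ⟨⌊K * y⌋, ?_, ?_, ?_, ?_⟩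
    · rw [abs_of_nonneg f0]
      have : (⌊K * y⌋ : ℝ) ≤ (K : ℤ) := f1.trans (by push_cast; nlinarith)
      exact_mod_cast this
    · rw [abs_of_nonneg (by positivity), abs_of_nonneg h0, div_le_iff₀ hK']
      linarith
    · rw [abs_of_nonneg, sub_le_iff_le_add, ← add_div, le_div_iff₀ hK']
      · linarith
      · rw [sub_nonneg, div_le_iff₀ hK']; linarith
    · rintro h rfl
      simp at h
  rcases le_total 0 y with h | h
  · exact nonneg y h ((le_abs_self y).trans hy)
  · obtain ⟨v, h1, h2, h3, h4⟩ := nonneg (-y) (by linarith) ((neg_le_abs y).trans hy)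
    refine ⟨-v, by rwa [abs_neg], ?_, ?_, fun hv hy => h4 (by simpa using hv) (by simpa using hy)⟩
    · push_cast; rw [neg_div, abs_neg]; simpa using h2
    · push_cast; rw [← abs_neg]; convert h3 using 2; ring

/-- Factor the difference of squares and estimate crudely. The polynomial loss is compensated by a
mesh `1 / K` that is a large negative power of n. -/
theorem abs_sum_sq_sub_le {R C : Type*} [Fintype R] [Fintype C] {Φ : R → C → ℝ}
    (hΦ : ∀ i j, |Φ i j| ≤ 1) {y y' : C → ℝ} (hy : ∀ j, |y j| ≤ 1) (hy' : ∀ j, |y' j| ≤ 1) {d : ℝ}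
    (hd : ∀ j, |y j - y' j| ≤ d) :
    |∑ i, (∑ j, Φ i j * y j) ^ 2 - ∑ i, (∑ j, Φ i j * y' j) ^ 2| ≤
      Fintype.card R * (2 * (Fintype.card C) ^ 2 * d) := by
  have bound : ∀ (i : R) (w : C → ℝ) (a : ℝ), (∀ j, |w j| ≤ a) →
      |∑ j, Φ i j * w j| ≤ Fintype.card C * a := by
    intro i w a hw
    refine (Finset.abs_sum_le_sum_abs _ _).trans ?_
    calc ∑ j, |Φ i j * w j| ≤ ∑ _j : C, a := Finset.sum_le_sum fun j _ => by
          rw [abs_mul]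
          nlinarith [hΦ i j, hw j, abs_nonneg (Φ i j), abs_nonneg (w j)]
      _ = _ := by simp
  rw [← Finset.sum_sub_distrib]
  refine (Finset.abs_sum_le_sum_abs _ _).trans ?_
  calc ∑ i, |(∑ j, Φ i j * y j) ^ 2 - (∑ j, Φ i j * y' j) ^ 2|
      ≤ ∑ _i : R, (2 * (Fintype.card C : ℝ) ^ 2 * d) := by
        refine Finset.sum_le_sum fun i _ => ?_
        have e : (∑ j, Φ i j * y j) ^ 2 - (∑ j, Φ i j * y' j) ^ 2 =
            (∑ j, Φ i j * (y j + y' j)) * ∑ j, Φ i j * (y j - y' j) := by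
          simp only [mul_add, mul_sub, Finset.sum_add_distrib, Finset.sum_sub_distrib]
          ring
        rw [e, abs_mul]
        have h1 := bound i (fun j => y j + y' j) 2 fun j =>
          (abs_add_le _ _).trans (by linarith [hy j, hy' j])
        have h2 := bound i (fun j => y j - y' j) d hd
        calc _ ≤ (Fintype.card C * 2 : ℝ) * (Fintype.card C * d) :=
              mul_le_mul h1 h2 (abs_nonneg _) (by positivity)
          _ = _ := by ring
    _ = _ := by simp

/-- By homogeneity the vector may be normalised. Rounding towards zero enlarges neither its norm nor
its support, so the result is again sparse and in the unit ball. -/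
theorem realRIP_of_grid {R C : Type*} [Fintype R] [Fintype C] {Φ : R → C → ℝ}
    (hΦ : ∀ i j, |Φ i j| ≤ 1) {k K : ℕ} (hK : 0 < K) {a : ℝ} (ha : 0 ≤ a)
    (h : ∀ f : Fin k → C × Fin (2 * K + 1), ∑ j, gridVector f j ^ 2 ≤ 1 →
      |∑ i, (∑ j, Φ i j * gridVector f j) ^ 2 - ∑ j, gridVector f j ^ 2| ≤ a) :
    RealRIP Φ k (a + (Fintype.card R * (2 * (Fintype.card C) ^ 2 * (1 / K)) +
      Fintype.card C * (2 * (1 / K)))) := by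
  classical
  intro x hx
  have hK' : (0 : ℝ) < K := by exact_mod_cast hK
  set S := ∑ j, x j ^ 2 with hS
  have hS0 : 0 ≤ S := Finset.sum_nonneg fun j _ => sq_nonneg _
  rcases hS0.eq_or_lt with h0 | hSpos
  · have hz : ∀ j, x j = 0 := fun j => by
      have := (Finset.sum_eq_zero_iff_of_nonneg fun j _ => sq_nonneg (x j)).1 h0.symm j
        (Finset.mem_univ j)
      exact pow_eq_zero_iff two_ne_zero |>.1 this
    rw [← h0]
    simp [hz]
  set y : C → ℝ := fun j => x j / √S with hy
  have hsq : √S ^ 2 = S := Real.sq_sqrt hS0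
  have hsqpos : 0 < √S := Real.sqrt_pos.2 hSpos
  have hysum : ∑ j, y j ^ 2 = 1 := by
    simp only [hy, div_pow, hsq, ← Finset.sum_div, ← hS]
    exact div_self hSpos.ne'
  have hy1 : ∀ j, |y j| ≤ 1 := fun j => by
    rw [← sq_le_one_iff_abs_le_one, ← hysum]
    exact Finset.single_le_sum (f := fun j => y j ^ 2) (fun j _ => sq_nonneg _) (Finset.mem_univ j)
  choose v hv1 hv2 hv3 hv4 using fun j => exists_round hK (hy1 j)
  set y' : C → ℝ := fun j => (v j : ℝ) / K with hy'
  have hy'1 : ∀ j, |y' j| ≤ 1 := fun j => (hv2 j).trans (hy1 j)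
  have hy'sum : ∑ j, y' j ^ 2 ≤ 1 := by
    rw [← hysum]
    exact Finset.sum_le_sum fun j _ => sq_le_sq.2 (hv2 j)
  have hgrid : |∑ i, (∑ j, Φ i j * y' j) ^ 2 - ∑ j, y' j ^ 2| ≤ a := by
    by_cases hne : ∃ j, v j ≠ 0
    · obtain ⟨f, hf⟩ := exists_gridVector_eq (k := k) v hv1 (le_trans (Finset.card_le_card (by
        intro j hj
        simp only [Finset.mem_filter, Finset.mem_univ, true_and] at hj ⊢
        intro h0
        exact hv4 j hj (by simp [hy, h0]))) hx) hne
      have := h f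
      simp only [hf] at this
      exact this hy'sum
    · push Not at hne
      simpa [hy', hne] using ha
  have hΦdiff := abs_sum_sq_sub_le hΦ hy1 hy'1 hv3
  have hIdiff : |∑ j, y j ^ 2 - ∑ j, y' j ^ 2| ≤ Fintype.card C * (2 * (1 / K)) := by
    rw [← Finset.sum_sub_distrib]
    refine (Finset.abs_sum_le_sum_abs _ _).trans ?_
    calc ∑ j, |y j ^ 2 - y' j ^ 2| ≤ ∑ _j : C, (2 * (1 / K) : ℝ) := by
          refine Finset.sum_le_sum fun j _ => ?_
          rw [sq_sub_sq, abs_mul]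
          exact mul_le_mul ((abs_add_le _ _).trans (by linarith [hy1 j, hy'1 j])) (hv3 j)
            (abs_nonneg _) (by norm_num)
      _ = _ := by simp
  have hfin : |∑ i, (∑ j, Φ i j * y j) ^ 2 - ∑ j, y j ^ 2| ≤
      a + (Fintype.card R * (2 * (Fintype.card C) ^ 2 * (1 / K)) +
        Fintype.card C * (2 * (1 / K))) := by
    rw [abs_le] at *
    constructor <;> linarith [hgrid.1, hgrid.2, hΦdiff.1, hΦdiff.2, hIdiff.1, hIdiff.2]
  have hscale : ∑ i, (∑ j, Φ i j * y j) ^ 2 = (∑ i, (∑ j, Φ i j * x j) ^ 2) / S := by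
    rw [Finset.sum_div]
    refine Finset.sum_congr rfl fun i _ => ?_
    have e : ∑ j, Φ i j * y j = (∑ j, Φ i j * x j) / √S := by
      rw [Finset.sum_div]
      simp only [hy, mul_div_assoc]
    rw [e, div_pow, hsq]
  rw [hysum, hscale, div_sub_one hSpos.ne', abs_div, abs_of_pos hSpos, div_le_iff₀ hSpos] at hfin
  exact hfin

open Classical in
/-- A matrix whose entries are affine functions of random signs most likely has the restricted
isometry property, if no sign occurs twice in a row or in more than two rows. -/
theorem card_not_realRIP_le {R C E : Type*} [Fintype R] [Fintype C] [Fintype E]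
    (D ν : R → C → ℝ) (b : R → C → E)
    (hb : ∀ i j j', ν i j ≠ 0 → ν i j' ≠ 0 → b i j = b i j' → j = j')
    (ht : ∀ e, (Finset.univ.filter fun i => ∃ j, ν i j ≠ 0 ∧ b i j = e).card ≤ 2)
    {r η u : ℝ} (hr : 0 < r) (hν : ∀ i j, ν i j ^ 2 ≤ r) (hη : η ≤ 1)
    (hM : ∀ y : C → ℝ, |∑ i, ((∑ j, D i j * y j) ^ 2 + ∑ j, ν i j ^ 2 * y j ^ 2) - ∑ j, y j ^ 2| ≤
      η * ∑ j, y j ^ 2)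
    (h1 : ∀ i j, |D i j| + |ν i j| ≤ 1) (hu : 0 < u) (hu1 : u ≤ 1) {k K : ℕ} (hK : 0 < K)
    {δ : ℝ} (hδ : u + η + (Fintype.card R * (2 * (Fintype.card C) ^ 2 * (1 / K)) +
      Fintype.card C * (2 * (1 / K))) ≤ δ) :
    ((Finset.univ.filter fun ω : E → Bool =>
      ¬ RealRIP (fun i j => D i j + ν i j * sgn (ω (b i j))) k δ).card : ℝ) ≤
      2 ^ Fintype.card E * ((Fintype.card C * (2 * K + 1)) ^ k *
        (2 * Real.exp (-(u ^ 2 / (64 * r))))) := by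
  rcases isEmpty_or_nonempty C with hC | hC
  · have : ∀ ω : E → Bool, RealRIP (fun i j => D i j + ν i j * sgn (ω (b i j))) k δ := by
      intro ω x _
      simp
    simp [this]
    positivity
  have hη0 : 0 ≤ η := by
    have := (abs_nonneg _).trans (hM fun _ => 1)
    simp only [one_pow, Finset.sum_const, nsmul_eq_mul, mul_one, Finset.card_univ] at this
    have hc : (0 : ℝ) < Fintype.card C := by exact_mod_cast Fintype.card_pos
    exact nonneg_of_mul_nonneg_left this hc
  set Φ : (E → Bool) → R → C → ℝ := fun ω i j => D i j + ν i j * sgn (ω (b i j)) with hΦ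
  have hΦ1 : ∀ ω i j, |Φ ω i j| ≤ 1 := fun ω i j => by
    refine (abs_add_le _ _).trans ?_
    rw [abs_mul]
    have : |sgn (ω (b i j))| = 1 := by unfold sgn; split_ifs <;> simp
    rw [this, mul_one]
    exact h1 i j
  set bad : (C → ℝ) → Finset (E → Bool) := fun y => Finset.univ.filter fun ω =>
    u + η ≤ |∑ i, (∑ j, Φ ω i j * y j) ^ 2 - ∑ j, y j ^ 2| with hbad
  have hbadcard : ∀ y : C → ℝ, ∑ j, y j ^ 2 ≤ 1 → ((bad y).card : ℝ) ≤
      2 ^ Fintype.card E * (2 * Real.exp (-(u ^ 2 / (64 * r)))) := by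
    intro y hy
    -- The coefficient of the sign `e` in row `i`. Since no sign occurs twice in a row, its sum has
    -- at most one nonzero term, and the squares add up without cross terms.
    set c : R → E → ℝ := fun i e => ∑ j, if b i j = e then ν i j * y j else 0 with hc
    have hcs : ∀ i, ∑ e, c i e ^ 2 = ∑ j, ν i j ^ 2 * y j ^ 2 := by
      intro i
      calc ∑ e, c i e ^ 2 = ∑ e, ∑ j, (if b i j = e then ν i j * y j * c i e else 0) := by
            refine Finset.sum_congr rfl fun e _ => ?_
            rw [sq]
            nth_rewrite 1 [hc]
            simp only [Finset.sum_mul, ite_mul, zero_mul]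
        _ = ∑ j, ν i j * y j * c i (b i j) := by
            rw [Finset.sum_comm]
            simp
        _ = _ := by
            refine Finset.sum_congr rfl fun j _ => ?_
            by_cases h0 : ν i j = 0
            · simp [h0]
            · have : c i (b i j) = ν i j * y j := by
                rw [hc]
                simp only
                rw [Finset.sum_eq_single j]
                · simp
                · intro j' _ hj'
                  split_ifs with he
                  · by_cases h0' : ν i j' = 0
                    · simp [h0']
                    · exact absurd (hb i j' j h0' h0 he) hj'
                  · rfl
                · simp
              rw [this]; ring
    have hlin : ∀ ω i, ∑ j, Φ ω i j * y j = ∑ j, D i j * y j + ∑ e, c i e * sgn (ω e) := by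
      intro ω i
      simp only [hΦ, hc, add_mul, Finset.sum_add_distrib, Finset.sum_mul, ite_mul, zero_mul]
      congr 1
      rw [Finset.sum_comm]
      refine Finset.sum_congr rfl fun j _ => ?_
      simp
      ring
    have htouch : ∀ e, (Finset.univ.filter fun i => c i e ≠ 0).card ≤ 2 := by
      intro e
      refine (Finset.card_le_card ?_).trans (ht e)
      intro i hi
      simp only [Finset.mem_filter, Finset.mem_univ, true_and] at hi ⊢
      obtain ⟨j, -, hj⟩ := Finset.exists_ne_zero_of_sum_ne_zero hi
      refine ⟨j, ?_, ?_⟩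
      · rintro h0
        simp [h0] at hj
      · by_contra h0
        simp [h0] at hj
    have hcr : ∀ i, ∑ e, c i e ^ 2 ≤ r := by
      intro i
      rw [hcs]
      calc ∑ j, ν i j ^ 2 * y j ^ 2 ≤ ∑ j, r * y j ^ 2 :=
            Finset.sum_le_sum fun j _ => mul_le_mul_of_nonneg_right (hν i j) (sq_nonneg _)
        _ ≤ r := by rw [← Finset.mul_sum]; nlinarith
    have hMy := hM y
    simp only [← hcs] at hMy
    have hη' : η * ∑ j, y j ^ 2 ≤ η := by nlinarith
    have hM2 := abs_le.1 (hMy.trans hη')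
    have := card_deviation_le c (fun i => ∑ j, D i j * y j) htouch hr hcr hu hu1 rfl
      (by linarith [hM2.2])
    refine le_trans ?_ this
    rw [Nat.cast_le]
    convert Finset.card_le_card ?_
    intro ω hω
    simp only [hbad, Finset.mem_filter, Finset.mem_univ, true_and, hlin] at hω ⊢
    have htri := abs_sub_le (∑ i, (∑ j, D i j * y j + ∑ e, c i e * sgn (ω e)) ^ 2)
      (∑ i, ((∑ j, D i j * y j) ^ 2 + ∑ e, c i e ^ 2)) (∑ j, y j ^ 2)
    linarith
  -- Union bound: failure on some sparse vector forces failure on one of the `(N (2 K + 1)) ^ k`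
  -- descriptions of grid vectors, `N` being the number of columns.
  have hsub : (Finset.univ.filter fun ω : E → Bool => ¬ RealRIP (Φ ω) k δ) ⊆
      (Finset.univ.filter fun f : Fin k → C × Fin (2 * K + 1) =>
        ∑ j, gridVector f j ^ 2 ≤ 1).biUnion fun f => bad (gridVector f) := by
    intro ω hω
    simp only [Finset.mem_filter, Finset.mem_univ, true_and] at hω
    by_contra hnot
    apply hω
    have := realRIP_of_grid (hΦ1 ω) hK (k := k) (a := u + η) (by linarith) (fun f hf => by
      by_contra hlt
      push Not at hlt
      refine hnot (Finset.mem_biUnion.2 ⟨f, by simpa using hf, ?_⟩)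
      simp only [hbad, Finset.mem_filter, Finset.mem_univ, true_and]
      exact hlt.le)
    intro x hx
    exact (this x hx).trans (mul_le_mul_of_nonneg_right hδ
      (Finset.sum_nonneg fun j _ => sq_nonneg _))
  have hcard := (Finset.card_le_card hsub).trans Finset.card_biUnion_le
  calc ((Finset.univ.filter fun ω : E → Bool => ¬ RealRIP (Φ ω) k δ).card : ℝ)
      ≤ ∑ f ∈ Finset.univ.filter (fun f : Fin k → C × Fin (2 * K + 1) =>
        ∑ j, gridVector f j ^ 2 ≤ 1), ((bad (gridVector f)).card : ℝ) := by exact_mod_cast hcard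
    _ ≤ ∑ f ∈ Finset.univ.filter (fun f : Fin k → C × Fin (2 * K + 1) =>
        ∑ j, gridVector f j ^ 2 ≤ 1),
        2 ^ Fintype.card E * (2 * Real.exp (-(u ^ 2 / (64 * r)))) :=
        Finset.sum_le_sum fun f hf => hbadcard _ (Finset.mem_filter.1 hf).2
    _ ≤ ∑ _f : Fin k → C × Fin (2 * K + 1),
        2 ^ Fintype.card E * (2 * Real.exp (-(u ^ 2 / (64 * r)))) :=
        Finset.sum_le_sum_of_subset_of_nonneg (Finset.filter_subset _ _)
          fun _ _ _ => by positivity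
    _ = _ := by
        simp only [Finset.sum_const, Finset.card_univ, Fintype.card_fun, Fintype.card_prod,
          Fintype.card_fin, nsmul_eq_mul]
        push_cast
        ring

/-! ### Transfer between real and complex vectors, blocks -/

open Classical in
theorem card_filter_ne_zero {C : Type*} [Fintype C] {α : Type*} [Zero α] (x : C → α) :
    (Finset.univ.filter fun j => x j ≠ 0).card = {j | x j ≠ 0}.ncard := by
  rw [Set.ncard_eq_toFinset_card']
  congr 1
  ext j
  simp

/-- Both parts of a k-sparse vector are k-sparse, and all the squared norms add up over the blocks,
so the parameter does not deteriorate. -/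
theorem RealRIP.fromBlocks {R₁ R₂ C₁ C₂ : Type*} [Fintype R₁] [Fintype R₂] [Fintype C₁]
    [Fintype C₂] {Φ : Matrix R₁ C₁ ℝ} {Ψ : Matrix R₂ C₂ ℝ} {k : ℕ} {δ : ℝ} (h₁ : RealRIP Φ k δ)
    (h₂ : RealRIP Ψ k δ) : RealRIP (Matrix.fromBlocks Φ 0 0 Ψ) k δ := by
  classical
  intro x hx
  have e₁ : (Finset.univ.filter fun j => x (Sum.inl j) ≠ 0).card ≤ k := by
    refine le_trans ?_ hx
    rw [← Finset.card_map Function.Embedding.inl (β := C₁ ⊕ C₂)]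
    refine Finset.card_le_card fun j hj => ?_
    obtain ⟨i, hi, rfl⟩ := Finset.mem_map.1 hj
    simpa using hi
  have e₂ : (Finset.univ.filter fun j => x (Sum.inr j) ≠ 0).card ≤ k := by
    refine le_trans ?_ hx
    rw [← Finset.card_map Function.Embedding.inr (β := C₁ ⊕ C₂)]
    refine Finset.card_le_card fun j hj => ?_
    obtain ⟨i, hi, rfl⟩ := Finset.mem_map.1 hj
    simpa using hi
  have a₁ := h₁ (fun j => x (Sum.inl j)) (by convert e₁)
  have a₂ := h₂ (fun j => x (Sum.inr j)) (by convert e₂)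
  simp only [Fintype.sum_sum_type, Matrix.fromBlocks_apply₁₁, Matrix.fromBlocks_apply₁₂,
    Matrix.fromBlocks_apply₂₁, Matrix.fromBlocks_apply₂₂, Matrix.zero_apply, zero_mul,
    Finset.sum_const_zero, add_zero, zero_add]
  rw [abs_le] at *
  constructor <;> linarith [a₁.1, a₁.2, a₂.1, a₂.2]

theorem RealRIP.reindex {R C R' C' : Type*} [Fintype R] [Fintype C] [Fintype R'] [Fintype C']
    {Φ : Matrix R C ℝ} {k : ℕ} {δ : ℝ} (h : RealRIP Φ k δ) (e : R ≃ R') (f : C ≃ C') :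
    RealRIP (Matrix.reindex e f Φ) k δ := by
  classical
  intro x hx
  have := h (fun j => x (f j)) (by
    refine le_trans (le_of_eq ?_) hx
    rw [card_filter_ne_zero, card_filter_ne_zero]
    have : {j | x j ≠ 0} = f '' {j | x (f j) ≠ 0} := by
      ext j
      simp only [Set.mem_ofPred_eq, Set.mem_image]
      exact ⟨fun hj => ⟨f.symm j, by simpa using hj, by simp⟩, by rintro ⟨i, hi, rfl⟩; exact hi⟩
    rw [this, Set.ncard_image_of_injective _ f.injective])
  rw [Equiv.sum_comp f fun j => x j ^ 2] at this
  convert this using 3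
  rw [← Equiv.sum_comp e]
  refine Finset.sum_congr rfl fun i _ => ?_
  rw [← Equiv.sum_comp f]
  simp

/-- A real matrix acts separately on real and imaginary parts, which are as sparse as the vector
itself. -/
theorem satisfiesRIP_of_realRIP {m N : ℕ} {Φ : Matrix (Fin m) (Fin N) ℚ} {k : ℕ} {δ : ℝ}
    (h : RealRIP (fun i j => (Φ i j : ℝ)) k δ) :
    SatisfiesRIP (Φ.map fun q : ℚ => (q : ℂ)) k δ := by
  intro x hx
  have hre := h (fun j => (x j).re) (by
    rw [card_filter_ne_zero]
    refine le_trans (Set.ncard_le_ncard (fun j hj => ?_) (Set.toFinite _)) hx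
    intro h0
    simp [h0] at hj)
  have him := h (fun j => (x j).im) (by
    rw [card_filter_ne_zero]
    refine le_trans (Set.ncard_le_ncard (fun j hj => ?_) (Set.toFinite _)) hx
    intro h0
    simp [h0] at hj)
  have e1 : ∑ j, ‖x j‖ ^ 2 = ∑ j, (x j).re ^ 2 + ∑ j, (x j).im ^ 2 := by
    rw [← Finset.sum_add_distrib]
    refine Finset.sum_congr rfl fun j _ => ?_
    rw [← Complex.normSq_eq_norm_sq, Complex.normSq_apply]; ring
  have e2 : ∑ i, ‖(Φ.map fun q : ℚ => (q : ℂ)).mulVec x i‖ ^ 2 =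
      ∑ i, (∑ j, (Φ i j : ℝ) * (x j).re) ^ 2 + ∑ i, (∑ j, (Φ i j : ℝ) * (x j).im) ^ 2 := by
    rw [← Finset.sum_add_distrib]
    refine Finset.sum_congr rfl fun i _ => ?_
    rw [← Complex.normSq_eq_norm_sq, Complex.normSq_apply, Matrix.mulVec, dotProduct,
      Complex.re_sum, Complex.im_sum]
    have a1 : ∀ j, ((Φ.map fun q : ℚ => (q : ℂ)) i j * x j).re = (Φ i j : ℝ) * (x j).re := by
      intro j; simp [Complex.mul_re]
    have a2 : ∀ j, ((Φ.map fun q : ℚ => (q : ℂ)) i j * x j).im = (Φ i j : ℝ) * (x j).im := by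
      intro j; simp [Complex.mul_im]
    simp only [a1, a2]
    ring
  rw [e1, e2]
  rw [abs_le] at hre him
  constructor <;> linarith [hre.1, hre.2, him.1, him.2]

theorem SatisfiesRIP.real {m N : ℕ} {Φ : Matrix (Fin m) (Fin N) ℚ} {k : ℕ} {δ : ℝ}
    (h : SatisfiesRIP (Φ.map fun q : ℚ => (q : ℂ)) k δ) (x : Fin N → ℝ)
    (hx : {j | x j ≠ 0}.ncard ≤ k) :
    |∑ i, (∑ j, (Φ i j : ℝ) * x j) ^ 2 - ∑ j, x j ^ 2| ≤ δ * ∑ j, x j ^ 2 := by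
  have := h (fun j => (x j : ℂ)) (by simpa using hx)
  have e1 : ∀ j, ‖(x j : ℂ)‖ ^ 2 = x j ^ 2 := fun j => by
    rw [Complex.norm_real, Real.norm_eq_abs, sq_abs]
  have e2 : ∀ i, ‖(Φ.map fun q : ℚ => (q : ℂ)).mulVec (fun j => (x j : ℂ)) i‖ ^ 2 =
      (∑ j, (Φ i j : ℝ) * x j) ^ 2 := fun i => by
    have : (Φ.map fun q : ℚ => (q : ℂ)).mulVec (fun j => (x j : ℂ)) i =
        ((∑ j, (Φ i j : ℝ) * x j : ℝ) : ℂ) := by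
      simp [Matrix.mulVec, dotProduct]
    rw [this, Complex.norm_real, Real.norm_eq_abs, sq_abs]
  simp only [e1, e2] at this
  rw [abs_le]
  constructor <;> linarith [this.1, this.2]

theorem ripParamRat_le {m N : ℕ} {Φ : Matrix (Fin m) (Fin N) ℚ} {k : ℕ} {δ : ℝ} (hδ : 0 ≤ δ)
    (h : RealRIP (fun i j => (Φ i j : ℝ)) k δ) : ripParamRat Φ k ≤ δ :=
  csInf_le ⟨0, fun _ h => h.1⟩ ⟨hδ, satisfiesRIP_of_realRIP h⟩

theorem ripParamRat_nonneg {m N : ℕ} (Φ : Matrix (Fin m) (Fin N) ℚ) (k : ℕ) :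
    0 ≤ ripParamRat Φ k :=
  Real.sInf_nonneg fun _ h => h.1

/-- The squared Frobenius norm bounds the upper side. This excludes the default value 0 of the
infimum of an empty set in `ripParam`. -/
theorem exists_satisfiesRIP {m N : ℕ} (Φ : Matrix (Fin m) (Fin N) ℂ) (k : ℕ) :
    ∃ δ, 0 ≤ δ ∧ SatisfiesRIP Φ k δ := by
  refine ⟨1 + ∑ i, ∑ j, ‖Φ i j‖ ^ 2, by positivity, fun x _ => ?_⟩
  have hx : 0 ≤ ∑ j, ‖x j‖ ^ 2 := by positivity
  have hS : 0 ≤ ∑ i, ∑ j, ‖Φ i j‖ ^ 2 := by positivity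
  constructor
  · have : 0 ≤ ∑ i, ‖Φ.mulVec x i‖ ^ 2 := by positivity
    nlinarith
  · have : ∑ i, ‖Φ.mulVec x i‖ ^ 2 ≤ (∑ i, ∑ j, ‖Φ i j‖ ^ 2) * ∑ j, ‖x j‖ ^ 2 := by
      rw [Finset.sum_mul]
      refine Finset.sum_le_sum fun i _ => ?_
      refine le_trans ?_ (Finset.sum_mul_sq_le_sq_mul_sq Finset.univ (fun j => ‖Φ i j‖)
        fun j => ‖x j‖)
      refine pow_le_pow_left₀ (norm_nonneg _) ?_ 2
      rw [Matrix.mulVec, dotProduct]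
      refine (norm_sum_le _ _).trans (le_of_eq ?_)
      simp
    nlinarith

theorem exists_satisfiesRIP_of_ripParamRat_lt {m N : ℕ} {Φ : Matrix (Fin m) (Fin N) ℚ} {k : ℕ}
    {δ : ℝ} (h : ripParamRat Φ k < δ) :
    ∃ δ' < δ, SatisfiesRIP (Φ.map fun q : ℚ => (q : ℂ)) k δ' := by
  obtain ⟨δ', h1, h2⟩ := exists_lt_of_csInf_lt (exists_satisfiesRIP _ k) h
  exact ⟨δ', h2, h1.2⟩

/-! ### Random graphs and random sign matrices -/

/-- The graph described by a set of unordered pairs; loops are ignored. -/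
def toGraph {n : ℕ} (ω : Sym2 (Fin n) → Bool) : SimpleGraph (Fin n) where
  Adj i j := i ≠ j ∧ ω s(i, j) = true
  symm := ⟨fun i j h => ⟨h.1.symm, by rw [Sym2.eq_swap]; exact h.2⟩⟩
  loopless := ⟨fun _ h => h.1 rfl⟩

open Classical in
/-- A set of unordered pairs is a graph together with a set of loops. -/
noncomputable def graphEquiv (n : ℕ) : (Sym2 (Fin n) → Bool) ≃
    SimpleGraph (Fin n) × ({e : Sym2 (Fin n) // e.IsDiag} → Bool) where
  toFun ω := (toGraph ω, fun d => ω d)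
  invFun x e := if h : e.IsDiag then x.2 ⟨e, h⟩ else decide (e ∈ x.1.edgeSet)
  left_inv ω := by
    funext e
    by_cases h : e.IsDiag
    · simp [h]
    · induction e using Sym2.ind with
      | _ i j =>
        simp only [h, dif_neg, not_false_iff, SimpleGraph.mem_edgeSet, toGraph]
        rw [Sym2.mk_isDiag_iff] at h
        simp [h]
  right_inv x := by
    refine Prod.ext ?_ ?_
    · ext i j
      by_cases h : i = j
      · subst h; simp [toGraph]
      · simp [toGraph, h]
    · funext d
      simp [d.2]

-- Passes from uniform graphs to independent signs on unordered pairs. The superfluous signs at the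
-- loops multiply every count by the same factor.
open Classical in
theorem ncard_graph_div (n : ℕ) (Q : SimpleGraph (Fin n) → Prop) :
    ({G | Q G}.ncard : ℝ) / (Nat.card (SimpleGraph (Fin n)) : ℝ) =
      ((Finset.univ.filter fun ω : Sym2 (Fin n) → Bool => Q (toGraph ω)).card : ℝ) /
        2 ^ Fintype.card (Sym2 (Fin n)) := by
  have key : ∀ Q : SimpleGraph (Fin n) → Prop,
      (Finset.univ.filter fun ω : Sym2 (Fin n) → Bool => Q (toGraph ω)).card =
        {G | Q G}.ncard * Nat.card ({e : Sym2 (Fin n) // e.IsDiag} → Bool) := by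
    intro Q
    have h1 : {ω | Q (toGraph ω)} = graphEquiv n ⁻¹' ({G | Q G} ×ˢ Set.univ) := by
      ext ω; simp [graphEquiv]
    have h2 : (Finset.univ.filter fun ω : Sym2 (Fin n) → Bool => Q (toGraph ω)).card =
        {ω | Q (toGraph ω)}.ncard := by
      rw [← Set.ncard_coe_finset]; simp
    rw [h2, h1, Set.ncard_preimage_of_injective_subset_range (graphEquiv n).injective
      (by simp), Set.ncard_prod, Set.ncard_univ]
  have h1 := key Q
  have h2 := key fun _ => True
  simp only [Finset.filter_true, Finset.card_univ, Fintype.card_fun, Fintype.card_bool] at h2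
  have h3 : {G : SimpleGraph (Fin n) | True}.ncard = Nat.card (SimpleGraph (Fin n)) := by
    rw [← Set.ncard_univ]; rfl
  rw [h3] at h2
  have h4 : (Nat.card ({e : Sym2 (Fin n) // e.IsDiag} → Bool) : ℝ) ≠ 0 := by
    rw [Nat.cast_ne_zero]; exact Nat.card_pos.ne'
  have h5 : (2 : ℝ) ^ Fintype.card (Sym2 (Fin n)) = (Nat.card (SimpleGraph (Fin n)) : ℝ) *
      Nat.card ({e : Sym2 (Fin n) // e.IsDiag} → Bool) := by exact_mod_cast h2
  rw [h1, h5, Nat.cast_mul, mul_div_mul_right _ _ h4]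

theorem quarterRoot_bounds {n : ℕ} (hn : 0 < n) :
    (n : ℝ) ≤ 16 * (quarterRoot n : ℝ) ^ 2 ∧
      16 * ((quarterRoot n : ℝ) - 1) ^ 2 + 1 ≤ n ∧ (1 : ℝ) ≤ quarterRoot n ∧
      √n ≤ 4 * quarterRoot n ∧ 4 * (quarterRoot n : ℝ) ≤ √n + 4 := by
  obtain ⟨h1, h2⟩ := quarterRoot_spec n
  have hpos := quarterRoot_pos hn
  obtain ⟨s, hs⟩ : ∃ s, quarterRoot n = s + 1 := ⟨quarterRoot n - 1, by omega⟩
  have h3 := h2 s (by omega)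
  have h1' : (n : ℝ) ≤ 16 * (quarterRoot n : ℝ) ^ 2 := by exact_mod_cast h1
  have h3' : 16 * (s : ℝ) ^ 2 + 1 ≤ n := by exact_mod_cast h3
  have hs' : (quarterRoot n : ℝ) = s + 1 := by exact_mod_cast hs
  refine ⟨h1', ?_, ?_, ?_, ?_⟩
  · rw [hs']; simpa using h3'
  · exact_mod_cast hpos
  · rw [Real.sqrt_le_left (by positivity)]; nlinarith
  · rw [hs']
    have : 4 * (s : ℝ) ≤ √n := Real.le_sqrt_of_sq_le (by nlinarith)
    linarith

/-- The error of replacing √n / 4 by an integer, which keeps the entries rational. It is used with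
`x = n - 1` for graph matrices, whose diagonal carries no sign, and with `x = n` for sign matrices.
-/
theorem quarterRoot_ratio {n : ℕ} (hn : 0 < n) {x : ℝ} (h1 : (n : ℝ) - 1 ≤ x) (h2 : x ≤ n) :
    |x / (16 * (quarterRoot n : ℝ) ^ 2) - 1| ≤ 8 / √n := by
  obtain ⟨a1, a2, a3, a4, -⟩ := quarterRoot_bounds hn
  set t : ℝ := (quarterRoot n : ℝ)
  have ht : 0 < 16 * t ^ 2 := by positivity
  have hs : 0 < √(n : ℝ) := Real.sqrt_pos.2 (by exact_mod_cast hn)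
  have h8 : 2 / t ≤ 8 / √n := by
    rw [div_le_div_iff₀ (by linarith) hs]; linarith
  refine le_trans ?_ h8
  rw [abs_le, div_sub_one ht.ne', div_le_div_iff₀ ht (by linarith), ← neg_div,
    div_le_div_iff₀ (by linarith) ht]
  constructor <;> nlinarith

theorem inv_sq_quarterRoot_le {n : ℕ} (hn : 0 < n) {c : ℝ} (hc : 4 ≤ c) :
    (1 / (c * quarterRoot n)) ^ 2 ≤ 1 / (n : ℝ) := by
  obtain ⟨a1, -, a3, -, -⟩ := quarterRoot_bounds hn
  have hn' : (0 : ℝ) < n := by exact_mod_cast hn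
  rw [div_pow, one_pow]
  apply one_div_le_one_div_of_le hn'
  refine a1.trans ?_
  rw [mul_pow]
  exact mul_le_mul_of_nonneg_right (by nlinarith) (sq_nonneg _)

-- The constants come from (3/5)² + (4/5)² = 1: the diagonal contributes 9/25 to the mean of the
-- squared norm and the signs contribute 16/25 · (n - 1)/(16 t²). By symmetry the sign of a pair
-- occurs only in the rows of its two members.
open Classical in
theorem card_graph_not_realRIP_le (σ : Bool) {n : ℕ} (hn : 64 ≤ n) {u δ : ℝ} (hu : 0 < u)
    (hu1 : u ≤ 1) {k K : ℕ} (hK : 0 < K)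
    (hδ : u + 8 / √n + (n * (2 * (n : ℝ) ^ 2 * (1 / K)) + n * (2 * (1 / K))) ≤ δ) :
    ((Finset.univ.filter fun ω : Sym2 (Fin n) → Bool =>
      ¬ RealRIP (fun i j => (graphMatrix σ (toGraph ω) i j : ℝ)) k δ).card : ℝ) ≤
      2 ^ Fintype.card (Sym2 (Fin n)) * ((n * (2 * K + 1)) ^ k *
        (2 * Real.exp (-(u ^ 2 * n / 64)))) := by
  have hn0 : 0 < n := by omega
  have hn' : (64 : ℝ) ≤ n := by exact_mod_cast hn
  obtain ⟨-, -, a3, -, -⟩ := quarterRoot_bounds hn0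
  set t : ℝ := (quarterRoot n : ℝ) with ht
  set τ : ℝ := if σ then 1 else -1 with hτ
  have hτ2 : τ ^ 2 = 1 := by rw [hτ]; split_ifs <;> norm_num
  have hτa : |τ| = 1 := by rw [hτ]; split_ifs <;> norm_num
  have h5 : |1 / (5 * t)| ≤ 1 := by
    rw [abs_of_nonneg (by positivity), div_le_one (by positivity)]; linarith
  have hη : 8 / √(n : ℝ) ≤ 1 := by
    rw [div_le_one (by positivity)]
    exact Real.le_sqrt_of_sq_le (by linarith)
  have key := card_not_realRIP_le
    (D := fun i j : Fin n => if i = j then (3 / 5 : ℝ) else 0)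
    (ν := fun i j : Fin n => if i = j then (0 : ℝ) else τ * (1 / (5 * t)))
    (b := fun i j => s(i, j)) (r := 1 / n) (η := 8 / √n) (u := u) (k := k) (K := K) (δ := δ)
    ?_ ?_ (by positivity) ?_ hη ?_ ?_ hu hu1 hK (by simpa using hδ)
  · rw [Fintype.card_fin] at key
    have e : u ^ 2 / (64 * (1 / (n : ℝ))) = u ^ 2 * n / 64 := by field_simp
    rw [e] at key
    convert key using 10 with ω i j
    unfold graphMatrix sgn
    by_cases hij : i = j
    · simp [hij]
    · by_cases hω : ω s(i, j) = true <;> cases σ <;>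
        simp [hij, toGraph, hω, hτ, ht, div_eq_mul_inv]
  · intro i j j' _ _ h
    exact Sym2.congr_right.1 h
  · intro e
    induction e using Sym2.ind with
    | _ p q =>
      refine (Finset.card_le_card (t := {p, q}) fun i hi => ?_).trans Finset.card_le_two
      simp only [Finset.mem_filter, Finset.mem_univ, true_and] at hi
      obtain ⟨j, -, hj⟩ := hi
      have : i ∈ s(p, q) := by rw [← hj]; simp
      simpa using this
  · intro i j
    split_ifs
    · simp
    · rw [mul_pow, hτ2, one_mul]
      exact inv_sq_quarterRoot_le hn0 (by norm_num)
  · intro y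
    have e1 : ∀ i, ∑ j, (if i = j then (3 / 5 : ℝ) else 0) * y j = 3 / 5 * y i := fun i => by
      simp [ite_mul]
    have e2 : ∀ i, ∑ j, (if i = j then (0 : ℝ) else τ * (1 / (5 * t))) ^ 2 * y j ^ 2 =
        (1 / (5 * t)) ^ 2 * (∑ j, y j ^ 2 - y i ^ 2) := by
      intro i
      have : ∀ j, (if i = j then (0 : ℝ) else τ * (1 / (5 * t))) ^ 2 * y j ^ 2 =
          (1 / (5 * t)) ^ 2 * (y j ^ 2 - if i = j then y j ^ 2 else 0) := by
        intro j
        split_ifs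
        · ring
        · rw [mul_pow, hτ2]; ring
      simp only [this, ← Finset.mul_sum, Finset.sum_sub_distrib]
      simp
    simp only [e1, e2]
    have e3 : ∑ i, ((3 / 5 * y i) ^ 2 + (1 / (5 * t)) ^ 2 * (∑ j, y j ^ 2 - y i ^ 2)) -
        ∑ j, y j ^ 2 = 16 / 25 * (((n : ℝ) - 1) / (16 * t ^ 2) - 1) * ∑ j, y j ^ 2 := by
      simp only [mul_pow, Finset.sum_add_distrib, ← Finset.mul_sum, Finset.sum_sub_distrib,
        Finset.sum_const, Finset.card_univ, Fintype.card_fin, nsmul_eq_mul]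
      field_simp
      ring
    rw [e3, abs_mul, abs_mul, abs_of_nonneg (by positivity : 0 ≤ ∑ j, y j ^ 2)]
    refine mul_le_mul_of_nonneg_right ?_ (by positivity)
    have := quarterRoot_ratio hn0 (x := (n : ℝ) - 1) le_rfl (by linarith)
    rw [abs_of_nonneg (by norm_num : (0 : ℝ) ≤ 16 / 25)]
    have h0 := abs_nonneg (((n : ℝ) - 1) / (16 * t ^ 2) - 1)
    linarith
  · intro i j
    split_ifs
    · norm_num
    · rw [abs_zero, abs_mul, hτa, one_mul, zero_add]; exact h5

open Classical in
theorem card_sign_not_realRIP_le {n b : ℕ} (hn : 64 ≤ n) {u δ : ℝ} (hu : 0 < u)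
    (hu1 : u ≤ 1) {k K : ℕ} (hK : 0 < K)
    (hδ : u + 8 / √n + (n * (2 * (b : ℝ) ^ 2 * (1 / K)) + b * (2 * (1 / K))) ≤ δ) :
    ((Finset.univ.filter fun ω : Fin n × Fin b → Bool =>
      ¬ RealRIP (fun i j => (signMatrix n ω i j : ℝ)) k δ).card : ℝ) ≤
      2 ^ Fintype.card (Fin n × Fin b) * ((b * (2 * K + 1)) ^ k *
        (2 * Real.exp (-(u ^ 2 * n / 64)))) := by
  have hn0 : 0 < n := by omega
  have hn' : (64 : ℝ) ≤ n := by exact_mod_cast hn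
  obtain ⟨-, -, a3, -, -⟩ := quarterRoot_bounds hn0
  set t : ℝ := (quarterRoot n : ℝ) with ht
  have h4 : |1 / (4 * t)| ≤ 1 := by
    rw [abs_of_nonneg (by positivity), div_le_one (by positivity)]; linarith
  have hη : 8 / √(n : ℝ) ≤ 1 := by
    rw [div_le_one (by positivity)]
    exact Real.le_sqrt_of_sq_le (by linarith)
  have key := card_not_realRIP_le
    (D := fun (_ : Fin n) (_ : Fin b) => (0 : ℝ)) (ν := fun _ _ => 1 / (4 * t))
    (b := fun i j => (i, j)) (r := 1 / n) (η := 8 / √n) (u := u) (k := k) (K := K) (δ := δ)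
    ?_ ?_ (by positivity) ?_ hη ?_ ?_ hu hu1 hK (by simpa using hδ)
  · rw [Fintype.card_fin] at key
    have e : u ^ 2 / (64 * (1 / (n : ℝ))) = u ^ 2 * n / 64 := by field_simp
    rw [e] at key
    convert key using 10 with ω i j
    unfold signMatrix sgn
    cases h : ω (i, j) <;> simp [ht, neg_div]
  · intro i j j' _ _ h
    exact (Prod.ext_iff.1 h).2
  · rintro ⟨p, q⟩
    refine (Finset.card_le_card (t := {p}) fun i hi => ?_).trans (by simp)
    simp only [Finset.mem_filter, Finset.mem_univ, true_and] at hi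
    obtain ⟨j, -, hj⟩ := hi
    simpa using (Prod.ext_iff.1 hj).1
  · intro i j
    exact inv_sq_quarterRoot_le hn0 (by norm_num)
  · intro y
    have e3 : ∑ _i : Fin n, ((∑ j, (0 : ℝ) * y j) ^ 2 + ∑ j, (1 / (4 * t)) ^ 2 * y j ^ 2) -
        ∑ j, y j ^ 2 = ((n : ℝ) / (16 * t ^ 2) - 1) * ∑ j, y j ^ 2 := by
      simp only [← Finset.mul_sum, Finset.sum_const, Finset.card_univ, Fintype.card_fin,
        nsmul_eq_mul, zero_mul]
      field_simp
      ring
    rw [e3, abs_mul, abs_of_nonneg (by positivity : 0 ≤ ∑ j, y j ^ 2)]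
    refine mul_le_mul_of_nonneg_right ?_ (by positivity)
    exact quarterRoot_ratio hn0 (by linarith) le_rfl
  · intro i j
    rw [abs_zero, zero_add]; exact h4

/-! ### Asymptotics of the parameters -/

theorem tendsto_rpow_natCast {a : ℝ} (ha : 0 < a) :
    Tendsto (fun n : ℕ => (n : ℝ) ^ a) atTop atTop :=
  (tendsto_rpow_atTop ha).comp tendsto_natCast_atTop_atTop

theorem lowParam_pos {ε : ℝ} {n : ℕ} (hn : 0 < n) : 0 < lowParam ε n :=
  Real.rpow_pos_of_pos (by exact_mod_cast hn) _

theorem highParam_pos {ε : ℝ} {n : ℕ} (hn : 0 < n) : 0 < highParam ε n :=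
  div_pos (Real.rpow_pos_of_pos (by exact_mod_cast hn) _) (by norm_num)

theorem lowParam_le_one {ε : ℝ} (hε₀ : 0 < ε) (hε₁ : ε < 1 / 2) {n : ℕ} (hn : 0 < n) :
    lowParam ε n ≤ 1 :=
  Real.rpow_le_one_of_one_le_of_nonpos (by exact_mod_cast hn) (by nlinarith)

theorem lowParam_isLittleO {ε : ℝ} (hε₀ : 0 < ε) (hε₁ : ε < 1 / 2) :
    lowParam ε =o[atTop] highParam ε := by
  rw [isLittleO_iff_tendsto' (by
    filter_upwards [eventually_gt_atTop 0] with n hn h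
    exact absurd h (highParam_pos hn).ne')]
  have h := ((tendsto_rpow_natCast (by nlinarith : 0 < -ε - (-5 * ε / 4 + ε ^ 2 / 2))
    ).inv_tendsto_atTop).const_mul 4
  rw [mul_zero] at h
  refine h.congr' ?_
  filter_upwards [eventually_gt_atTop 0] with n hn
  have hn0 : (0 : ℝ) < n := by exact_mod_cast hn
  have := Real.rpow_pos_of_pos hn0 (-ε)
  have := Real.rpow_pos_of_pos hn0 (-5 * ε / 4 + ε ^ 2 / 2)
  rw [Pi.inv_apply, Real.rpow_sub hn0, lowParam, highParam]
  field_simp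

/-- Half of δ is reserved for random deviation. The bias of the mean and the rounding error with
mesh n^(-4) are O(n^(-1/2)), and √n δ tends to infinity because its exponent is (1 - 2ε)(1 - ε/2)/2.
-/
theorem eventually_slack {ε : ℝ} (hε₀ : 0 < ε) (hε₁ : ε < 1 / 2) (A : ℕ) :
    ∀ᶠ n : ℕ in atTop, lowParam ε n / 2 + 8 / √(n : ℝ) +
      (n * (2 * ((A * n : ℕ) : ℝ) ^ 2 * (1 / ((n ^ 4 : ℕ) : ℝ))) +
        ((A * n : ℕ) : ℝ) * (2 * (1 / ((n ^ 4 : ℕ) : ℝ)))) ≤ lowParam ε n := by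
  have hpos : 0 < 1 / 2 + (-5 * ε / 4 + ε ^ 2 / 2) := by nlinarith
  filter_upwards [(tendsto_rpow_natCast hpos).eventually_ge_atTop (2 * (8 + 2 * A ^ 2 + 2 * A)),
    eventually_ge_atTop 1] with n hn hn1
  have hn1' : (1 : ℝ) ≤ n := by exact_mod_cast hn1
  have hn0 : (0 : ℝ) < n := by linarith
  rw [Real.rpow_add hn0, ← Real.sqrt_eq_rpow] at hn
  change _ ≤ √(n : ℝ) * lowParam ε n at hn
  have hs : 1 ≤ √(n : ℝ) := Real.one_le_sqrt.2 hn1'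
  have hsq : √(n : ℝ) ^ 2 = n := Real.sq_sqrt hn0.le
  have h1 : (n : ℝ) * (2 * ((A * n : ℕ) : ℝ) ^ 2 * (1 / ((n ^ 4 : ℕ) : ℝ))) ≤
      2 * A ^ 2 / √(n : ℝ) := by
    push_cast
    have : (n : ℝ) * (2 * (A * n) ^ 2 * (1 / n ^ 4)) = 2 * A ^ 2 / n := by field_simp
    rw [this]
    exact div_le_div_of_nonneg_left (by positivity) (by positivity) (by nlinarith)
  have h2 : ((A * n : ℕ) : ℝ) * (2 * (1 / ((n ^ 4 : ℕ) : ℝ))) ≤ 2 * A / √(n : ℝ) := by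
    push_cast
    have : (A * n : ℝ) * (2 * (1 / n ^ 4)) = 2 * A / n ^ 3 := by field_simp
    rw [this]
    refine div_le_div_of_nonneg_left (by positivity) (by positivity) ?_
    calc √(n : ℝ) ≤ n := by nlinarith
      _ ≤ (n : ℝ) ^ 3 := le_self_pow₀ hn1' (by norm_num)
  have h3 : 8 / √(n : ℝ) + 2 * A ^ 2 / √(n : ℝ) + 2 * A / √(n : ℝ) ≤ lowParam ε n / 2 := by
    rw [← add_div, ← add_div, div_le_iff₀ (by linarith)]
    linarith
  linarith

/-- With κ the exponent of k and η = (ε/2)(1 - 2ε) > 0, one has δ²n = n^(κ + η), whereas the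
logarithm of the number of grid descriptions is O(n^κ log n). The extra n^η absorbs the logarithm,
at the price of half the exponent: 1/512 instead of 1/256. -/
theorem tendsto_failure {ε : ℝ} (hε₀ : 0 < ε) (hε₁ : ε < 1 / 2) (A : ℕ) (hA : 0 < A) :
    Tendsto (fun n : ℕ => (((A * n : ℕ) : ℝ) * (2 * ((n ^ 4 : ℕ) : ℝ) + 1)) ^ ripOrder ε n *
      (2 * Real.exp (-((lowParam ε n / 2) ^ 2 * n / 64)))) atTop (𝓝 0) := by
  set κ : ℝ := (1 - 2 * ε) * (1 - ε) with hκ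
  set η : ℝ := ε / 2 - ε ^ 2 with hη
  have hκ0 : 0 < κ := mul_pos (by linarith) (by linarith)
  have hη0 : 0 < η := by rw [hη]; nlinarith
  have hlog : ∀ᶠ n : ℕ in atTop, Real.log (3 * A) + 5 * Real.log n ≤ (n : ℝ) ^ η / 512 := by
    have h1 : (fun n : ℕ => Real.log (3 * A) + 5 * Real.log (n : ℝ)) =o[atTop]
        fun n : ℕ => (n : ℝ) ^ η := by
      refine IsLittleO.add ?_ ?_
      · refine isLittleO_const_left.2 (Or.inr ?_)
        exact tendsto_norm_atTop_atTop.comp (tendsto_rpow_natCast hη0)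
      · exact ((isLittleO_log_rpow_atTop hη0).comp_tendsto
          tendsto_natCast_atTop_atTop).const_mul_left 5
    filter_upwards [h1.bound (by norm_num : (0 : ℝ) < 1 / 512)] with n hn
    rw [Real.norm_of_nonneg (by positivity : (0 : ℝ) ≤ (n : ℝ) ^ η)] at hn
    exact (le_abs_self _).trans (hn.trans (by linarith))
  have hbound : Tendsto (fun n : ℕ => 2 * Real.exp (-((n : ℝ) ^ (κ + η) / 512))) atTop (𝓝 0) := by
    rw [← mul_zero (2 : ℝ)]
    refine Tendsto.const_mul 2 (Real.tendsto_exp_neg_atTop_nhds_zero.comp ?_)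
    exact (tendsto_rpow_natCast (by linarith)).atTop_div_const (by norm_num)
  refine squeeze_zero' (Eventually.of_forall fun n => by positivity) ?_ hbound
  filter_upwards [hlog, eventually_ge_atTop 1] with n hn hn1
  have hn1' : (1 : ℝ) ≤ n := by exact_mod_cast hn1
  have hn0 : (0 : ℝ) < n := by linarith
  have hA' : (1 : ℝ) ≤ A := by exact_mod_cast hA
  set B : ℝ := ((A * n : ℕ) : ℝ) * (2 * ((n ^ 4 : ℕ) : ℝ) + 1) with hB
  have hn4 : (1 : ℝ) ≤ (n : ℝ) ^ 4 := one_le_pow₀ hn1'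
  have hBle : B ≤ 3 * A * (n : ℝ) ^ 5 := by
    rw [hB]; push_cast
    have : (A * n : ℝ) * (2 * n ^ 4 + 1) ≤ (A * n : ℝ) * (3 * n ^ 4) :=
      mul_le_mul_of_nonneg_left (by linarith) (by positivity)
    linarith
  have hB1 : 1 ≤ B := by
    rw [hB]; push_cast
    have : (1 : ℝ) ≤ A * n := one_le_mul_of_one_le_of_one_le hA' hn1'
    nlinarith
  have hlogB : Real.log B ≤ (n : ℝ) ^ η / 512 := by
    refine (Real.log_le_log (by linarith) hBle).trans (le_trans (le_of_eq ?_) hn)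
    rw [Real.log_mul (by positivity) (by positivity), Real.log_pow]
    norm_num
  have hk : (ripOrder ε n : ℝ) ≤ (n : ℝ) ^ κ := Nat.floor_le (by positivity)
  have hpow : B ^ ripOrder ε n ≤ Real.exp ((n : ℝ) ^ (κ + η) / 512) := by
    rw [← Real.exp_log (by linarith : 0 < B), ← Real.exp_nat_mul]
    refine Real.exp_le_exp.2 ?_
    calc (ripOrder ε n : ℝ) * Real.log B ≤ (n : ℝ) ^ κ * ((n : ℝ) ^ η / 512) :=
          mul_le_mul hk hlogB (Real.log_nonneg hB1) (by positivity)
      _ = _ := by rw [Real.rpow_add hn0]; ring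
  have hexp : (lowParam ε n / 2) ^ 2 * n / 64 = (n : ℝ) ^ (κ + η) / 256 := by
    have : (n : ℝ) ^ (κ + η) = lowParam ε n ^ 2 * n := by
      rw [lowParam, ← Real.rpow_natCast, ← Real.rpow_mul hn0.le]
      nth_rewrite 3 [← Real.rpow_one (n : ℝ)]
      rw [← Real.rpow_add hn0]
      congr 1
      rw [hκ, hη]; push_cast; ring
    rw [this]; ring
  rw [hexp]
  calc B ^ ripOrder ε n * (2 * Real.exp (-((n : ℝ) ^ (κ + η) / 256)))
      ≤ Real.exp ((n : ℝ) ^ (κ + η) / 512) * (2 * Real.exp (-((n : ℝ) ^ (κ + η) / 256))) :=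
        mul_le_mul_of_nonneg_right hpow (by positivity)
    _ = 2 * Real.exp (-((n : ℝ) ^ (κ + η) / 512)) := by
        rw [mul_left_comm, ← Real.exp_add]
        congr 2
        ring

theorem eventually_clique {ε : ℝ} (hε₀ : 0 < ε) (hε₁ : ε < 1 / 2) :
    ∀ᶠ n : ℕ in atTop, 1 ≤ ⌊(n : ℝ) ^ (1 / 2 - ε)⌋₊ ∧
      ⌊(n : ℝ) ^ (1 / 2 - ε)⌋₊ ≤ ripOrder ε n ∧
      2 * highParam ε n ≤
        12 / 5 * (1 / (5 * quarterRoot n)) * ((⌊(n : ℝ) ^ (1 / 2 - ε)⌋₊ : ℝ) - 1) := by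
  -- The bound 5 leaves room for the three losses in the last estimate: the floor in the clique
  -- size, the -1 in w - 1, and the rounding of t.
  filter_upwards [(tendsto_rpow_natCast (by linarith : 0 < 1 / 2 - ε)).eventually_ge_atTop 5,
    eventually_ge_atTop 1] with n hn hn1
  have hn1' : (1 : ℝ) ≤ n := by exact_mod_cast hn1
  have hn0 : (0 : ℝ) < n := by linarith
  refine ⟨Nat.le_floor (by push_cast; linarith), ?_, ?_⟩
  · refine Nat.floor_le_floor (Real.rpow_le_rpow_of_exponent_le hn1' ?_)
    nlinarith
  · obtain ⟨-, -, h3, -, h5⟩ := quarterRoot_bounds hn1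
    have hw := Nat.sub_one_lt_floor ((n : ℝ) ^ (1 / 2 - ε))
    have hx : (n : ℝ) ^ (1 / 2 - ε) = √(n : ℝ) * (n : ℝ) ^ (-ε) := by
      rw [sub_eq_add_neg, Real.rpow_add hn0, Real.sqrt_eq_rpow]
    have hy1 : (n : ℝ) ^ (-ε) ≤ 1 := Real.rpow_le_one_of_one_le_of_nonpos hn1' (by linarith)
    have hy0 : 0 ≤ (n : ℝ) ^ (-ε) := by positivity
    set y : ℝ := (n : ℝ) ^ (-ε) with hy
    set w : ℝ := (⌊(n : ℝ) ^ (1 / 2 - ε)⌋₊ : ℝ) with hw'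
    set t : ℝ := (quarterRoot n : ℝ) with ht
    have e : 12 / 5 * (1 / (5 * t)) * (w - 1) = 12 * (w - 1) / (25 * t) := by
      field_simp
      ring
    rw [e, highParam, ← hy, le_div_iff₀ (by linarith)]
    have h6 : y * (4 * t) ≤ √(n : ℝ) * y + 4 := by nlinarith
    rw [← hx] at h6
    linarith

/-! ### Cliques force a large restricted isometry parameter -/

theorem blockMatrix_mulVec_sq {n a b m N : ℕ} (hm : n + a = m) (hN : n + b = N)
    (Φ : Matrix (Fin n) (Fin n) ℚ) (Ψ : Matrix (Fin a) (Fin b) ℚ) (y : Fin n → ℝ) :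
    ∑ i, (∑ j, (blockMatrix hm hN Φ Ψ i j : ℝ) *
      (Sum.elim y 0 ((finSumFinEquiv.trans (finCongr hN)).symm j) : ℝ)) ^ 2 =
      ∑ i, (∑ j, (Φ i j : ℝ) * y j) ^ 2 := by
  rw [← Equiv.sum_comp (finSumFinEquiv.trans (finCongr hm))]
  simp only [← Equiv.sum_comp (finSumFinEquiv.trans (finCongr hN)), blockMatrix,
    Matrix.reindex_apply, Matrix.submatrix_apply, Equiv.symm_apply_apply]
  simp [Fintype.sum_sum_type]

-- Polarisation: the sum of the two matrices is 6/5 I, and their difference is twice the signed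
-- adjacency matrix over 5t. Rows outside the clique contribute nothing, since the sum matrix maps
-- the indicator to a multiple of itself.
open Classical in
theorem graphMatrix_sq_sub_sq {n : ℕ} (G : SimpleGraph (Fin n)) {S : Finset (Fin n)}
    (hS : G.IsClique S) :
    ∑ i, (∑ j, (graphMatrix true G i j : ℝ) * (if j ∈ S then 1 else 0)) ^ 2 -
      ∑ i, (∑ j, (graphMatrix false G i j : ℝ) * (if j ∈ S then 1 else 0)) ^ 2 =
      12 / 5 * (1 / (5 * quarterRoot n)) * ((S.card : ℝ) - 1) * S.card := by
  set ν : ℝ := 1 / (5 * (quarterRoot n : ℝ)) with hν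
  have hadd : ∀ i j, (graphMatrix true G i j : ℝ) + graphMatrix false G i j =
      if i = j then 6 / 5 else 0 := by
    intro i j
    unfold graphMatrix
    by_cases hij : i = j
    · simp [hij]; norm_num
    · by_cases h : G.Adj i j <;> simp [hij, h] <;> ring
  have hsub : ∀ i ∈ S, ∀ j ∈ S, (graphMatrix true G i j : ℝ) - graphMatrix false G i j =
      2 * ν - if i = j then 2 * ν else 0 := by
    intro i hi j hj
    unfold graphMatrix
    by_cases hij : i = j
    · simp [hij]
    · simp [hij, hS hi hj hij, hν]; ring
  rw [← Finset.sum_sub_distrib]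
  have hterm : ∀ i, (∑ j, (graphMatrix true G i j : ℝ) * (if j ∈ S then 1 else 0)) ^ 2 -
      (∑ j, (graphMatrix false G i j : ℝ) * (if j ∈ S then 1 else 0)) ^ 2 =
      if i ∈ S then 12 / 5 * ν * ((S.card : ℝ) - 1) else 0 := by
    intro i
    rw [sq_sub_sq, ← Finset.sum_add_distrib, ← Finset.sum_sub_distrib]
    simp only [← add_mul, ← sub_mul, hadd]
    by_cases hi : i ∈ S
    · have h2 : ∑ j, ((graphMatrix true G i j : ℝ) - graphMatrix false G i j) *
          (if j ∈ S then 1 else 0) = 2 * ν * ((S.card : ℝ) - 1) := by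
        simp only [mul_ite, mul_one, mul_zero, Finset.sum_ite_mem, Finset.univ_inter]
        rw [Finset.sum_congr rfl (hsub i hi), Finset.sum_sub_distrib]
        simp [hi]
        ring
      rw [h2]
      simp [hi]
      ring
    · simp [hi]
  simp only [hterm, Finset.sum_ite_mem, Finset.univ_inter, Finset.sum_const, nsmul_eq_mul]
  ring

/-- If both parameters were below h, the two squared norms of the clique indicator, extended by
zero, would differ by less than 2hw. The second block never sees this vector, so it may be
arbitrary. -/
theorem le_ripParamRat_of_clique {n a b m N k w : ℕ} (hm : n + a = m) (hN : n + b = N)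
    {G : SimpleGraph (Fin n)} (hG : ¬ G.CliqueFree w) (Ψ : Matrix (Fin a) (Fin b) ℚ) (hw : 1 ≤ w)
    (hwk : w ≤ k) {h : ℝ} (hh : 2 * h ≤ 12 / 5 * (1 / (5 * quarterRoot n)) * ((w : ℝ) - 1)) :
    h ≤ ripParamRat (blockMatrix hm hN (graphMatrix true G) Ψ) k ∨
      h ≤ ripParamRat (blockMatrix hm hN (graphMatrix false G) Ψ) k := by
  classical
  by_contra hcon
  push Not at hcon
  obtain ⟨δ₁, h₁, r₁⟩ := exists_satisfiesRIP_of_ripParamRat_lt hcon.1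
  obtain ⟨δ₂, h₂, r₂⟩ := exists_satisfiesRIP_of_ripParamRat_lt hcon.2
  simp only [SimpleGraph.CliqueFree, not_forall, not_not] at hG
  obtain ⟨S, hS⟩ := hG
  set y : Fin n → ℝ := fun j => if j ∈ S then 1 else 0 with hy
  set x : Fin N → ℝ := fun j => Sum.elim y 0 ((finSumFinEquiv.trans (finCongr hN)).symm j) with hx
  have hxS : ∑ j, x j ^ 2 = w := by
    rw [← Equiv.sum_comp (finSumFinEquiv.trans (finCongr hN))]
    simp only [hx, Equiv.symm_apply_apply]
    simp [Fintype.sum_sum_type, hy, hS.card_eq]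
  have hxk : {j | x j ≠ 0}.ncard ≤ k := by
    refine le_trans ?_ (hS.card_eq.le.trans hwk)
    have : {j | x j ≠ 0} ⊆
        ((S.image fun i => (finSumFinEquiv.trans (finCongr hN)) (Sum.inl i) : Finset _) :
          Set (Fin N)) := by
      intro j hj
      obtain ⟨i, rfl⟩ := (finSumFinEquiv.trans (finCongr hN)).surjective j
      simp only [hx, Set.mem_ofPred_eq, Equiv.symm_apply_apply] at hj
      rcases i with i | i
      · simp only [Sum.elim_inl, hy, ne_eq, ite_eq_right_iff, one_ne_zero, imp_false,
          not_not] at hj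
        exact Finset.mem_coe.2 (Finset.mem_image.2 ⟨i, hj, rfl⟩)
      · simp at hj
    refine (Set.ncard_le_ncard this (Finset.finite_toSet _)).trans ?_
    rw [Set.ncard_coe_finset]
    exact Finset.card_image_le
  have a₁ := abs_le.1 (r₁.real x hxk)
  have a₂ := abs_le.1 (r₂.real x hxk)
  have e := graphMatrix_sq_sub_sq G hS.isClique
  rw [hS.card_eq] at e
  rw [hxS, blockMatrix_mulVec_sq] at a₁ a₂
  have hw' : (1 : ℝ) ≤ w := by exact_mod_cast hw
  have h3 := a₁.2
  have h4 := a₂.1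
  have h5 : (δ₁ + δ₂) * w < 2 * h * w := by
    apply mul_lt_mul_of_pos_right <;> linarith
  have h6 := mul_le_mul_of_nonneg_right hh (by linarith : (0 : ℝ) ≤ w)
  linarith

/-! ### Most matrices have a small restricted isometry parameter -/

theorem ripParamRat_blockMatrix_le {n a b m N k : ℕ} (hm : n + a = m) (hN : n + b = N)
    {Φ : Matrix (Fin n) (Fin n) ℚ} {Ψ : Matrix (Fin a) (Fin b) ℚ} {δ : ℝ} (hδ : 0 ≤ δ)
    (hΦ : RealRIP (fun i j => (Φ i j : ℝ)) k δ) (hΨ : RealRIP (fun i j => (Ψ i j : ℝ)) k δ) :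
    ripParamRat (blockMatrix hm hN Φ Ψ) k ≤ δ := by
  refine ripParamRat_le hδ ?_
  have h := (RealRIP.fromBlocks (Φ := Φ.map fun q => (q : ℝ)) (Ψ := Ψ.map fun q => (q : ℝ)) hΦ
    hΨ).reindex (finSumFinEquiv.trans (finCongr hm)) (finSumFinEquiv.trans (finCongr hN))
  have e : (fun i j => (blockMatrix hm hN Φ Ψ i j : ℝ)) =
      Matrix.reindex (finSumFinEquiv.trans (finCongr hm)) (finSumFinEquiv.trans (finCongr hN))
        (Matrix.fromBlocks (Φ.map fun q => (q : ℝ)) 0 0 (Ψ.map fun q => (q : ℝ))) := by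
    funext i j
    simp only [blockMatrix, Matrix.reindex_apply, Matrix.submatrix_apply]
    rcases (finSumFinEquiv.trans (finCongr hm)).symm i with i | i <;>
      rcases (finSumFinEquiv.trans (finCongr hN)).symm j with j | j <;> simp
  rw [e]
  exact h

/-- Both graph matrices of `G` have the restricted isometry property. -/
def GoodGraph (ε : ℝ) {n : ℕ} (G : SimpleGraph (Fin n)) : Prop :=
  ∀ σ, RealRIP (fun i j => (graphMatrix σ G i j : ℝ)) (ripOrder ε n) (lowParam ε n)

theorem tendsto_goodGraph {ε : ℝ} (hε₀ : 0 < ε) (hε₁ : ε < 1 / 2) :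
    Tendsto (fun n : ℕ => ({G : SimpleGraph (Fin n) | GoodGraph ε G}.ncard : ℝ) /
      (Nat.card (SimpleGraph (Fin n)) : ℝ)) atTop (𝓝 1) := by
  classical
  have hlow := (tendsto_failure hε₀ hε₁ 1 one_pos).const_mul (2 : ℝ)
  rw [mul_zero] at hlow
  have hlow' := hlow.const_sub 1
  rw [sub_zero] at hlow'
  refine tendsto_of_tendsto_of_tendsto_of_le_of_le' hlow' tendsto_const_nhds ?_
    (Eventually.of_forall fun n => ?_)
  · filter_upwards [eventually_slack hε₀ hε₁ 1, eventually_ge_atTop 64] with n hn hn64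
    have hn0 : 0 < n := by omega
    rw [ncard_graph_div, le_div_iff₀ (by positivity), sub_mul, one_mul, sub_le_iff_le_add]
    rw [one_mul] at hn ⊢
    have hl := lowParam_pos (ε := ε) hn0
    have hl1 := lowParam_le_one hε₀ hε₁ hn0
    have hc := fun σ => card_graph_not_realRIP_le σ hn64 (u := lowParam ε n / 2) (by linarith)
      (by linarith) (k := ripOrder ε n) (K := n ^ 4) (by positivity) hn
    have hun : (Finset.univ : Finset (Sym2 (Fin n) → Bool)) ⊆
        (Finset.univ.filter fun ω => GoodGraph ε (toGraph ω)) ∪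
        ((Finset.univ.filter fun ω => ¬ RealRIP
          (fun i j => (graphMatrix true (toGraph ω) i j : ℝ)) (ripOrder ε n) (lowParam ε n)) ∪
        (Finset.univ.filter fun ω => ¬ RealRIP
          (fun i j => (graphMatrix false (toGraph ω) i j : ℝ)) (ripOrder ε n) (lowParam ε n))) := by
      intro ω _
      simp only [Finset.mem_union, Finset.mem_filter, Finset.mem_univ, true_and, GoodGraph,
        Bool.forall_bool]
      tauto
    have h1 := (Finset.card_le_card hun).trans ((Finset.card_union_le _ _).trans
      (Nat.add_le_add_left (Finset.card_union_le _ _) _))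
    rw [Finset.card_univ, Fintype.card_fun, Fintype.card_bool] at h1
    have h2 := (Nat.cast_le (α := ℝ)).2 h1
    push_cast at h2
    have h3 := hc true
    have h4 := hc false
    push_cast at h3 h4 ⊢
    linarith
  · refine div_le_one_of_le₀ ?_ (Nat.cast_nonneg _)
    rw [Nat.cast_le, ← Set.ncard_univ]
    exact Set.ncard_le_ncard (Set.subset_univ _)

/-- With `c = 0` the sign block has no columns and every coin sequence is good; with `p = 1` it has
n rows, matching the scaling of its entries. -/
theorem eventually_goodCoins {ε : ℝ} (hε₀ : 0 < ε) (hε₁ : ε < 1 / 2) {p c : ℕ}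
    (hpc : c = 0 ∨ p = 1) :
    ∀ᶠ n : ℕ in atTop, ∀ (L : ℕ) (hL : p * n * (c * n) = L),
      3 / 4 * (2 : ℝ) ^ L ≤ ({r : Fin L → Bool | RealRIP
        (fun i j => (signMatrix n (coinMatrix hL r) i j : ℝ)) (ripOrder ε n)
          (lowParam ε n)}.ncard : ℝ) := by
  classical
  rcases Nat.eq_zero_or_pos c with rfl | hc
  · filter_upwards with n L hL
    have : {r : Fin L → Bool | RealRIP (fun i j => (signMatrix n (coinMatrix hL r) i j : ℝ))
        (ripOrder ε n) (lowParam ε n)} = Set.univ := by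
      refine Set.eq_univ_of_forall fun r x _ => ?_
      have hemp : IsEmpty (Fin (0 * n)) := by rw [zero_mul]; infer_instance
      simp
    rw [this, Set.ncard_univ, Nat.card_eq_fintype_card, Fintype.card_fun, Fintype.card_bool,
      Fintype.card_fin]
    push_cast
    have : (0 : ℝ) < 2 ^ L := by positivity
    linarith
  · obtain rfl : p = 1 := by omega
    filter_upwards [eventually_slack hε₀ hε₁ c, eventually_ge_atTop 64,
      (tendsto_failure hε₀ hε₁ c hc).eventually_le_const (by norm_num : (0 : ℝ) < 1 / 4)]
      with n hn hn64 hfail L hL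
    have hn0 : 0 < n := by omega
    have hl := lowParam_pos (ε := ε) hn0
    have hl1 := lowParam_le_one hε₀ hε₁ hn0
    -- The row index type is `Fin (1 * n)`; a variable number of rows allows `1 * n` to be replaced
    -- by `n`.
    have gen : ∀ (a : ℕ) (_ : a = n) (hL : a * (c * n) = L),
        3 / 4 * (2 : ℝ) ^ L ≤ ({r : Fin L → Bool | RealRIP
          (fun i j => (signMatrix n (coinMatrix hL r) i j : ℝ)) (ripOrder ε n)
            (lowParam ε n)}.ncard : ℝ) := by
      rintro a rfl hL
      have hcard := card_sign_not_realRIP_le hn64 (b := c * a) (u := lowParam ε a / 2)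
        (by linarith) (by linarith) (k := ripOrder ε a) (K := a ^ 4) (by positivity) hn
      have hcard' := hcard.trans (mul_le_mul_of_nonneg_left hfail (by positivity))
      set Q : (Fin a × Fin (c * a) → Bool) → Prop := fun ω =>
        RealRIP (fun i j => (signMatrix a ω i j : ℝ)) (ripOrder ε a) (lowParam ε a) with hQ
      have hbij : Function.Bijective (coinMatrix hL) :=
        (Equiv.arrowCongr (finProdFinEquiv.trans (finCongr hL)).symm (Equiv.refl Bool)).bijective
      have h1 : {r : Fin L → Bool | Q (coinMatrix hL r)}.ncard =
          (Finset.univ.filter Q).card := by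
        rw [← Set.ncard_coe_finset, Finset.coe_filter_univ]
        exact Set.ncard_preimage_of_injective_subset_range (s := {ω | Q ω}) hbij.injective
          (by rw [hbij.surjective.range_eq]; exact Set.subset_univ _)
      have h2 := Finset.card_filter_add_card_filter_not (s := Finset.univ) Q
      rw [Finset.card_univ, Fintype.card_fun, Fintype.card_bool] at h2
      have h3 : ((Finset.univ.filter Q).card : ℝ) +
          ((Finset.univ.filter fun ω => ¬ Q ω).card : ℝ) =
          2 ^ Fintype.card (Fin a × Fin (c * a)) := by exact_mod_cast h2
      have h4 : Fintype.card (Fin a × Fin (c * a)) = L := by simp [hL]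
      rw [h4] at h3 hcard'
      change _ ≤ (({r : Fin L → Bool | Q (coinMatrix hL r)}.ncard : ℕ) : ℝ)
      rw [h1]
      linarith
    exact gen (1 * n) (one_mul n) hL

/-! ### The reduction -/

theorem Outputs.unique {P : Prog} {x y z : Data} (hy : Outputs P x y) (hz : Outputs P x z) :
    y = z := by
  obtain ⟨s, hs⟩ := hy
  obtain ⟨t, ht⟩ := hz
  exact (ht.deterministic hs).1

/-- Turns a hypothetical program into a function, to which the closure properties apply;
`PolyTimeFunOn.exists_prog` goes back. -/
theorem PolyTimeOn.exists_fun {P : Prog} {S : Set Data} (h : PolyTimeOn P S) :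
    ∃ f, PolyTimeFunOn S f ∧ ∀ x ∈ S, Outputs P x (f x) := by
  classical
  obtain ⟨q, hq⟩ := h
  choose! f t h1 h2 using hq
  exact ⟨f, ⟨P, q, fun x hx => ⟨t x, h1 x hx, h2 x hx⟩⟩, fun x hx => ⟨t x, h1 x hx⟩⟩

theorem PolyTimeFunOn.exists_prog {S : Set Data} {f : Data → Data} (h : PolyTimeFunOn S f) :
    ∃ P, PolyTimeOn P S ∧ ∀ x ∈ S, Outputs P x (f x) := by
  obtain ⟨P, q, hP⟩ := h
  refine ⟨P, ⟨q, fun x hx => ?_⟩, fun x hx => ?_⟩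
  · obtain ⟨t, h1, h2⟩ := hP x hx
    exact ⟨_, t, h1, h2⟩
  · obtain ⟨t, h1, -⟩ := hP x hx
    exact ⟨t, h1⟩

open Classical in
/-- The answer on a graph and coin tosses, given a function `f` that distinguishes matrices: `yes`
for graphs with at most `n₀` vertices, and otherwise if `f` answers `no` on one of the two matrices
of the graph. -/
noncomputable def cliqueAnswer (f : Data → Data) (p c n₀ : ℕ) (x : Data) : Data :=
  if encList (x.fst.toList.drop n₀) = Data.nil then yes
  else if f (matrixData true p c x) = Data.nil then yes
  else if f (matrixData false p c x) = Data.nil then yes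
  else no

theorem polyTimeFunOn_cliqueAnswer {f : Data → Data} {p c : ℕ} (n₀ : ℕ) {S T : Set Data}
    (hf : PolyTimeFunOn T f) (h : ∀ σ, ∀ x ∈ S, matrixData σ p c x ∈ T) :
    PolyTimeFunOn S (cliqueAnswer f p c n₀) := by
  have hcomp : ∀ σ, PolyTimeFunOn S fun x => f (matrixData σ p c x) := fun σ =>
    hf.comp ((polyTime_matrixData σ p c).on S) (h σ)
  have hdrop : PolyTime fun x => encList (x.fst.toList.drop n₀) := by
    have := PolyTime.drop_length (PolyTime.const (encList (List.replicate n₀ Data.nil)))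
      PolyTime.id.fst
    simpa using this
  refine PolyTimeFunOn.ite (hdrop.on S) ?_ ((PolyTime.const yes).on _)
  refine PolyTimeFunOn.ite ((hcomp true).mono fun x hx => hx.1) ?_ ((PolyTime.const yes).on _)
  exact PolyTimeFunOn.ite ((hcomp false).mono fun x hx => hx.1.1) ((PolyTime.const no).on _)
    ((PolyTime.const yes).on _)

/-- Distinguishing matrices of size `(1 + p) n × (1 + c) n` refutes cliques. -/
theorem not_distinguishesRIP {ε : ℝ} (hε₀ : 0 < ε) (hε₁ : ε < 1 / 2) (hyp : CliqueHypothesis ε)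
    {p c : ℕ} (hpc : c = 0 ∨ p = 1) :
    ¬ ∃ P, DistinguishesRIP ε (fun n => (1 + p) * n) (fun n => (1 + c) * n) P := by
  classical
  rintro ⟨P, hP, hdist⟩
  apply hyp
  obtain ⟨f, hf, hPf⟩ := hP.exists_fun
  -- The distinguisher is correct only for large n, but "yes" must be right for every n. Up to `n₀`
  -- vertices the answer is always "yes", which does not affect the limit.
  obtain ⟨n₀, hn₀⟩ := eventually_atTop.1
    (hdist.and ((eventually_clique hε₀ hε₁).and (eventually_goodCoins hε₀ hε₁ hpc)))
  have hm : ∀ n, n + p * n = (1 + p) * n := fun n => by ring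
  have hN : ∀ n, n + c * n = (1 + c) * n := fun n => by ring
  set ℓ : Polynomial ℕ := Polynomial.C (p * c) * Polynomial.X ^ 2 with hℓ
  have hL : ∀ n, p * n * (c * n) = ℓ.eval n := fun n => by simp [hℓ]; ring
  set S : Set Data := {x | ∃ (n : ℕ) (G : SimpleGraph (Fin n)) (r : Fin (ℓ.eval n) → Bool),
    x = Data.node (encGraph G) (encCoins r)} with hS
  have hmap : ∀ σ, ∀ x ∈ S,
      matrixData σ p c x ∈ matrixInputs (fun n => (1 + p) * n) (fun n => (1 + c) * n) := by
    rintro σ _ ⟨n, G, r, rfl⟩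
    exact ⟨n, _, matrixData_eq σ (hm n) (hN n) (hL n) G r⟩
  obtain ⟨Q, hQ, hQf⟩ := (polyTimeFunOn_cliqueAnswer n₀ hf hmap).exists_prog
  have hdropnil : ∀ (n : ℕ) (G : SimpleGraph (Fin n)) (r : Fin (ℓ.eval n) → Bool),
      encList ((Data.node (encGraph G) (encCoins r)).fst.toList.drop n₀) = Data.nil ↔ n ≤ n₀ := by
    intro n G r
    rw [encList_eq_nil, List.drop_eq_nil_iff]
    simp [encGraph]
  refine ⟨Q, ℓ, hQ, fun n G hG r => ?_, ?_⟩
  · have hmem : Data.node (encGraph G) (encCoins r) ∈ S := ⟨n, G, r, rfl⟩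
    have hout := hQf _ hmem
    suffices h : cliqueAnswer f p c n₀ (Data.node (encGraph G) (encCoins r)) = yes by rwa [h] at hout
    unfold cliqueAnswer
    by_cases hn : n ≤ n₀
    · rw [if_pos ((hdropnil n G r).2 hn)]
    rw [if_neg (by rwa [hdropnil])]
    obtain ⟨hd, ⟨c1, c2, c3⟩, -⟩ := hn₀ n (by omega)
    -- This holds for every coin sequence `r`, whence the one-sided error.
    have hno : ∀ σ, highParam ε n ≤ ripParamRat (blockMatrix (hm n) (hN n) (graphMatrix σ G)
        (signMatrix n (coinMatrix (hL n) r))) (ripOrder ε n) →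
        f (matrixData σ p c (Data.node (encGraph G) (encCoins r))) = Data.nil := by
      intro σ h
      have h1 := (hd _).2 h
      rw [← matrixData_eq σ (hm n) (hN n) (hL n) G r] at h1
      exact (hPf _ (hmap σ _ hmem)).unique h1
    rcases le_ripParamRat_of_clique (hm n) (hN n) hG (signMatrix n (coinMatrix (hL n) r)) c1 c2 c3
      with h | h
    · rw [if_pos (hno true h)]
    · rw [if_pos (hno false h), ite_self]
  · refine tendsto_of_tendsto_of_tendsto_of_le_of_le' (tendsto_goodGraph hε₀ hε₁)
      tendsto_const_nhds ?_ (Eventually.of_forall fun n => ?_)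
    · filter_upwards [eventually_gt_atTop n₀, eventually_gt_atTop 0] with n hn hn0
      refine div_le_div_of_nonneg_right ?_ (Nat.cast_nonneg _)
      rw [Nat.cast_le]
      refine Set.ncard_le_ncard (fun G hG => ?_) (Set.toFinite _)
      obtain ⟨hd, -, hc⟩ := hn₀ n hn.le
      have hgood := hc _ (hL n)
      change 3 / 4 ≤ probNo Q (ℓ.eval n) G
      rw [probNo, le_div_iff₀ (by positivity)]
      refine hgood.trans ?_
      rw [Nat.cast_le]
      refine Set.ncard_le_ncard (fun r hr => ?_) (Set.toFinite _)
      have hmem : Data.node (encGraph G) (encCoins r) ∈ S := ⟨n, G, r, rfl⟩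
      have hout := hQf _ hmem
      -- Good graph and good coins: both block matrices have a small parameter, so the distinguisher
      -- accepts both and "no" is the answer.
      have hyes : ∀ σ, f (matrixData σ p c (Data.node (encGraph G) (encCoins r))) = yes := by
        intro σ
        have h1 := (hd _).1 (ripParamRat_blockMatrix_le (hm n) (hN n) (lowParam_pos hn0).le
          (hG σ) hr)
        rw [← matrixData_eq σ (hm n) (hN n) (hL n) G r] at h1
        exact (hPf _ (hmap σ _ hmem)).unique h1
      suffices h : cliqueAnswer f p c n₀ (Data.node (encGraph G) (encCoins r)) = no by
        rw [h] at hout; exact hout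
      unfold cliqueAnswer
      rw [if_neg (by rw [hdropnil]; omega), hyes, hyes, if_neg yes_ne_nil, if_neg yes_ne_nil]
    · refine div_le_one_of_le₀ ?_ (Nat.cast_nonneg _)
      rw [Nat.cast_le, ← Set.ncard_univ]
      exact Set.ncard_le_ncard (Set.subset_univ _)

/-! ### Approximation within a constant factor -/

open Classical in
/-- The comparison of a fraction `a / b` with `n ^ (-p / s)`, up to a constant factor: the number of
bits of `b` is compared with those of `a` and of the number of rows of the matrix. The argument is
the pair of the matrix and of the fraction. -/
noncomputable def thresholdAnswer (s p : ℕ) (z : Data) : Data :=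
  if z.snd.fst.snd = Data.nil then yes
  else if encList ((List.replicate s z.snd.snd.toList).flatten.drop
      ((List.replicate s z.snd.fst.snd.toList).flatten ++
        (List.replicate p (encNat z.fst.toList.length).toList).flatten).length) = Data.nil then no
  else yes

theorem polyTime_thresholdAnswer (s p : ℕ) : PolyTime (thresholdAnswer s p) := by
  have h := PolyTime.drop_length
    ((PolyTime.id.snd.fst.snd.flatten_replicate s).append
      (PolyTime.id.fst.encNat_length.flatten_replicate p))
    (PolyTime.id.snd.snd.flatten_replicate s)
  simp only [toList_encList] at h
  exact PolyTime.ite PolyTime.id.snd.fst.snd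
    (PolyTime.ite h (PolyTime.const yes) (PolyTime.const no)) (PolyTime.const yes)

theorem thresholdAnswer_encFrac (s p : ℕ) (x : Data) (a : ℤ) (b : ℕ) :
    thresholdAnswer s p (Data.node x (encFrac a b)) =
      if a.natAbs ≠ 0 ∧
        s * b.size ≤ s * a.natAbs.size + p * Nat.size x.toList.length then no else yes := by
  have hlen : ∀ m : ℕ, (encNat m).toList.length = m.size := fun m => by
    simp [encNat, Nat.size_eq_bits_len]
  have hnil : encNat a.natAbs = Data.nil ↔ a.natAbs = 0 := by
    rw [encNat, encList_eq_nil, List.map_eq_nil_iff, ← List.length_eq_zero_iff,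
      Nat.size_eq_bits_len, Nat.size_eq_zero]
  unfold thresholdAnswer
  simp only [snd_node, fst_node, encFrac, encInt, hnil, encList_eq_nil, List.drop_eq_nil_iff,
    List.length_append, List.length_flatten, List.map_replicate, List.sum_replicate, hlen,
    smul_eq_mul]
  by_cases h1 : a.natAbs = 0
  · simp [h1]
  · simp [h1]

/-- A bit length determines a number up to a factor 2, so comparing multiples of bit lengths
compares A/b with n^(-p/s) up to a constant, without any multiplication of numerals. -/
theorem pow_le_of_size_le {s p A b n L : ℕ} (hA : 0 < A) (hL : 2 ^ L ≤ 4 * n)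
    (h : s * b.size ≤ s * A.size + p * L) : b ^ s ≤ (2 * A) ^ s * (4 * n) ^ p := by
  have h2 : 2 ^ A.size ≤ 2 * A := by
    obtain ⟨m, hm⟩ : ∃ m, A.size = m + 1 := ⟨A.size - 1, by have := Nat.size_pos.2 hA; omega⟩
    have := Nat.lt_size.1 (show m < A.size by omega)
    rw [hm, pow_succ]
    omega
  calc b ^ s ≤ (2 ^ b.size) ^ s := Nat.pow_le_pow_left (Nat.lt_size_self b).le s
    _ = 2 ^ (s * b.size) := by rw [← pow_mul, mul_comm]
    _ ≤ 2 ^ (s * A.size + p * L) := Nat.pow_le_pow_right (by norm_num) h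
    _ = (2 ^ A.size) ^ s * (2 ^ L) ^ p := by rw [pow_add, ← pow_mul, ← pow_mul]; ring_nf
    _ ≤ _ := Nat.mul_le_mul (Nat.pow_le_pow_left h2 s) (Nat.pow_le_pow_left hL p)

theorem pow_lt_of_size_lt {s p A b n L : ℕ} (hb : 0 < b) (hL : 2 * n ≤ 2 ^ L)
    (h : s * A.size + p * L < s * b.size) : A ^ s * (2 * n) ^ p < (2 * b) ^ s := by
  have h2 : 2 ^ b.size ≤ 2 * b := by
    obtain ⟨m, hm⟩ : ∃ m, b.size = m + 1 := ⟨b.size - 1, by have := Nat.size_pos.2 hb; omega⟩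
    have := Nat.lt_size.1 (show m < b.size by omega)
    rw [hm, pow_succ]
    omega
  calc A ^ s * (2 * n) ^ p ≤ (2 ^ A.size) ^ s * (2 ^ L) ^ p :=
        Nat.mul_le_mul (Nat.pow_le_pow_left (Nat.lt_size_self A).le s) (Nat.pow_le_pow_left hL p)
    _ = 2 ^ (s * A.size + p * L) := by rw [pow_add, ← pow_mul, ← pow_mul]; ring_nf
    _ < 2 ^ (s * b.size) := Nat.pow_lt_pow_right (by norm_num) h
    _ = (2 ^ b.size) ^ s := by rw [← pow_mul, mul_comm]
    _ ≤ _ := Nat.pow_le_pow_left h2 s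

/-- Take a rational p/s strictly between ε and 5ε/4 - ε²/2. Then n^(-p/s) is separated from both
parameters by powers of n, which eventually outweigh c and the factors lost in the comparison of bit
lengths. -/
theorem exists_threshold {ε : ℝ} (hε₀ : 0 < ε) (hε₁ : ε < 1 / 2) {c : ℝ} (hc : 1 ≤ c) :
    ∃ s p : ℕ, ∀ᶠ n : ℕ in atTop, (2 * (c * lowParam ε n)) ^ s * (4 * n) ^ p < 1 ∧
      1 ≤ (highParam ε n / (2 * c)) ^ s * (2 * n) ^ p := by
  obtain ⟨r, hr1, hr2⟩ := exists_rat_btwn (show ε < 5 * ε / 4 - ε ^ 2 / 2 by nlinarith)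
  have hden : (0 : ℝ) < r.den := by exact_mod_cast r.pos
  have hr0 : 0 < r := by have : (0 : ℝ) < r := hε₀.trans hr1; exact_mod_cast this
  have hnum : ((r.num.toNat : ℕ) : ℝ) = r * r.den := by
    have h1 : ((r.num.toNat : ℤ) : ℝ) = (r.num : ℝ) := by
      rw [Int.toNat_of_nonneg (Rat.num_nonneg.2 hr0.le)]
    rw [Int.cast_natCast] at h1
    rw [h1]
    exact_mod_cast (Rat.mul_den_eq_num r).symm
  refine ⟨r.den, r.num.toNat, ?_⟩
  set s := r.den
  set p := r.num.toNat
  have key : ∀ (e : ℝ) (n : ℕ), 0 < n → ((n : ℝ) ^ e) ^ s * (n : ℝ) ^ p = (n : ℝ) ^ (e * s + p) := by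
    intro e n hn
    have hn0 : (0 : ℝ) < n := by exact_mod_cast hn
    rw [← Real.rpow_natCast, ← Real.rpow_mul hn0.le, ← Real.rpow_natCast, ← Real.rpow_add hn0]
  have hlow : Tendsto (fun n : ℕ => (2 * c) ^ s * 4 ^ p *
      (n : ℝ) ^ ((-5 * ε / 4 + ε ^ 2 / 2) * s + p)) atTop (𝓝 0) := by
    rw [← mul_zero ((2 * c) ^ s * 4 ^ p)]
    refine Tendsto.const_mul _ ?_
    have := (tendsto_rpow_neg_atTop (y := -((-5 * ε / 4 + ε ^ 2 / 2) * s + p))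
      (by rw [hnum]; nlinarith)).comp tendsto_natCast_atTop_atTop
    rw [neg_neg] at this
    exact this
  have hhigh : Tendsto (fun n : ℕ => (1 / (8 * c)) ^ s * 2 ^ p *
      (n : ℝ) ^ (-ε * s + p)) atTop atTop :=
    (tendsto_rpow_natCast (by rw [hnum]; nlinarith)).const_mul_atTop (by positivity)
  filter_upwards [hlow.eventually_lt_const one_pos, hhigh.eventually_ge_atTop 1,
    eventually_gt_atTop 0] with n h1 h2 hn
  constructor
  · refine lt_of_eq_of_lt ?_ h1
    rw [← key _ _ hn, lowParam]
    ring
  · refine h2.trans (le_of_eq ?_)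
    rw [← key _ _ hn, highParam]
    have : (n : ℝ) ^ (-ε) / 4 / (2 * c) = 1 / (8 * c) * (n : ℝ) ^ (-ε) := by
      field_simp
      norm_num
    rw [this]
    ring

/-- An approximation algorithm yields an algorithm that distinguishes. -/
theorem ApproximatesRIP.exists_distinguishesRIP {ε : ℝ} (hε₀ : 0 < ε) (hε₁ : ε < 1 / 2) {c : ℝ}
    (hc : 1 ≤ c) {cols : ℕ → ℕ} {P : Prog} (h : ApproximatesRIP ε c (fun n => 2 * n) cols P) :
    ∃ Q, DistinguishesRIP ε (fun n => 2 * n) cols Q := by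
  obtain ⟨hP, happ⟩ := h
  obtain ⟨f, hf, hPf⟩ := hP.exists_fun
  obtain ⟨s, p, hsp⟩ := exists_threshold hε₀ hε₁ hc
  have hcomp : PolyTimeFunOn (matrixInputs (fun n => 2 * n) cols)
      fun x => thresholdAnswer s p (Data.node x (f x)) :=
    ((polyTime_thresholdAnswer s p).on Set.univ).comp ((PolyTime.id.on _).pair hf)
      fun _ _ => trivial
  obtain ⟨Q, hQ, hQf⟩ := hcomp.exists_prog
  refine ⟨Q, hQ, ?_⟩
  filter_upwards [happ, hsp, eventually_gt_atTop 0] with n hn hs hn0 Φ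
  obtain ⟨hs1, hs2⟩ := hs
  obtain ⟨a, b, hb, hout, hq1, hq2⟩ := hn Φ
  have hmem : encMatrix Φ ∈ matrixInputs (fun n => 2 * n) cols := ⟨n, Φ, rfl⟩
  have hQout := hQf _ hmem
  rw [(hPf _ hmem).unique hout, thresholdAnswer_encFrac] at hQout
  have hlen : (encMatrix Φ).toList.length = 2 * n := by simp [encMatrix]
  rw [hlen] at hQout
  have hL1 : 2 ^ Nat.size (2 * n) ≤ 4 * n := by
    obtain ⟨m, hm⟩ : ∃ m, Nat.size (2 * n) = m + 1 :=
      ⟨Nat.size (2 * n) - 1, by have := Nat.size_pos.2 (show 0 < 2 * n by omega); omega⟩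
    have := Nat.lt_size.1 (show m < Nat.size (2 * n) by omega)
    rw [hm, pow_succ]
    omega
  have hL2 : 2 * n ≤ 2 ^ Nat.size (2 * n) := (Nat.lt_size_self _).le
  have hρ := ripParamRat_nonneg Φ (ripOrder ε n)
  set ρ := ripParamRat Φ (ripOrder ε n)
  have hb' : (0 : ℝ) < b := by exact_mod_cast hb
  -- The threshold test ignores the sign of the fraction. This is legitimate because `0 ≤ ρ ≤ c q`
  -- forces `q` to be nonnegative.
  have hq0 : 0 ≤ (a : ℝ) / b := by
    by_contra hneg
    push Not at hneg
    nlinarith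
  have ha0 : (0 : ℝ) ≤ a := by
    have := mul_nonneg hq0 hb'.le
    rwa [div_mul_cancel₀ _ hb'.ne'] at this
  have haA : (a : ℝ) = (a.natAbs : ℝ) := by
    rw [Nat.cast_natAbs, abs_of_nonneg (by exact_mod_cast ha0)]
  set A := a.natAbs
  rw [haA] at hq1 hq2
  constructor
  · intro hle
    rwa [if_neg] at hQout
    rintro ⟨hA, hsize⟩
    have h1 := pow_le_of_size_le (Nat.pos_of_ne_zero hA) hL1 hsize
    have h1' : (b : ℝ) ^ s ≤ (2 * A) ^ s * (4 * n) ^ p := by exact_mod_cast h1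
    have h2 : (A : ℝ) ≤ c * lowParam ε n * b := by
      rw [← div_le_iff₀ hb']
      exact hq2.trans (mul_le_mul_of_nonneg_left hle (by linarith))
    have h3 : (2 * A : ℝ) ^ s ≤ (2 * (c * lowParam ε n)) ^ s * b ^ s := by
      rw [← mul_pow]
      exact pow_le_pow_left₀ (by positivity) (by linarith) s
    have h4 := mul_le_mul_of_nonneg_right h3 (by positivity : (0 : ℝ) ≤ (4 * n) ^ p)
    have h5 : (0 : ℝ) < (b : ℝ) ^ s := by positivity
    nlinarith
  · intro hle
    have hhigh := highParam_pos (ε := ε) hn0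
    have h2 : highParam ε n / c * b ≤ A := by
      rw [← le_div_iff₀ hb', div_le_iff₀ (by linarith), mul_comm]
      exact hle.trans hq1
    have hA : A ≠ 0 := by
      intro h0
      rw [h0, Nat.cast_zero] at h2
      have : 0 < highParam ε n / c * b := by positivity
      linarith
    rwa [if_pos] at hQout
    refine ⟨hA, ?_⟩
    by_contra hlt
    push Not at hlt
    have h1 := pow_lt_of_size_lt hb hL2 hlt
    have h1' : (A : ℝ) ^ s * (2 * n) ^ p < (2 * b) ^ s := by exact_mod_cast h1
    have h3 : (highParam ε n / (2 * c)) ^ s * (2 * b) ^ s ≤ (A : ℝ) ^ s := by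
      rw [← mul_pow]
      refine pow_le_pow_left₀ (by positivity) (le_trans (le_of_eq ?_) h2) s
      field_simp
    have h4 := mul_le_mul_of_nonneg_right h3 (by positivity : (0 : ℝ) ≤ (2 * n) ^ p)
    have h5 : (0 : ℝ) < (2 * (b : ℝ)) ^ s := by positivity
    nlinarith

end RIPHardness

theorem mainTheorem3 (ε : ℝ) (hε₀ : 0 < ε) (hε₁ : ε < 1 / 2)
    (hyp : RIPHardness.CliqueHypothesis ε) :
    -- distinguishing is hard for `n × n` matrices
    (¬ ∃ P : RIPHardness.Prog,
      RIPHardness.DistinguishesRIP ε (fun n => n) (fun n => n) P) ∧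
    -- distinguishing is hard for `2n × 100n` matrices
    (¬ ∃ P : RIPHardness.Prog,
      RIPHardness.DistinguishesRIP ε (fun n => 2 * n) (fun n => 100 * n) P) ∧
    -- the gap between the two parameters exceeds every constant factor
    (RIPHardness.lowParam ε =o[atTop] RIPHardness.highParam ε) ∧
    -- approximation within a constant factor is hard for `2n × 100n` matrices
    (∀ c : ℝ, 1 ≤ c → ¬ ∃ P : RIPHardness.Prog,
      RIPHardness.ApproximatesRIP ε c (fun n => 2 * n) (fun n => 100 * n) P) := by
  have h1 := RIPHardness.not_distinguishesRIP hε₀ hε₁ hyp (p := 0) (c := 0) (Or.inl rfl)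
  -- Next to the n × n graph block, a sign block of size n × 99n makes up 2n × 100n.
  have h2 := RIPHardness.not_distinguishesRIP hε₀ hε₁ hyp (p := 1) (c := 99) (Or.inr rfl)
  simp only [add_zero, one_mul] at h1
  norm_num only at h2
  refine ⟨h1, h2, RIPHardness.lowParam_isLittleO hε₀ hε₁, fun c hc => ?_⟩
  rintro ⟨P, hP⟩
  exact h2 (hP.exists_distinguishesRIP hε₀ hε₁ hc)
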